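/- A slick $k$-expression is built from atoms $i(v)$, which create a vertex $v$ with label $i\in[k]$, and binary operations $\oplus_{S,L,R}$ with $S\subseteq[k]\times[k]$ and $L,R:[k]\to[k]$. The labeled graph $G\oplus_{S,L,R}H$ is obtained from the disjoint union of $G$ and $H$ by adding all edges between vertices labeled $i$ in $G$ and vertices labeled $j$ in $H$ for $(i,j)\in S$, and then relabeling the vertices of $G$ by $L$ and those of $H$ by $R$. Deleting the labels gives the graph generated by the expression. The algorithm \texttt{diagonalize} takes a slick $k$-expression and a real number $c$, processes the parse tree in post order, and keeps at every node a box $[k',k'',M,\Lambda]$: a matrix $$M=\begin{pmatrix}M^{(0)}&M^{(1)}\\ M^{(1)T}&M^{(2)}\end{pmatrix}$$ with $k'$ rows of type i (those of $M^{(0)}$) and $k''$ rows of type ii (those of $M^{(2)}$), and a label in $[k]$ for each row. Every row operation below is accompanied by the same column operation. * At a leaf $i(v)$ the box is $[0,1,(-c),(i)]$. * At a node $Q_\ell\oplus_{S,L,R}Q_r$ (at the root, $L$ and $R$ are first replaced by one common constant map): 1. Form the block-diagonal union of the two boxes' matrices, and put a $1$ in the two symmetric positions given by a type-ii row labeled $i$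 of the left box and a type-ii row labeled $j$ of the right box whenever $(i,j)\in S$. Relabel the rows by $L$ and $R$, respectively, and permute so that the type-i rows come first. 2. While two type-ii rows $j\ne j'$ have equal labels, do $R_{j'}\leftarrow R_{j'}-R_j$ and let $j'$ become a type-i row. 3. If $k'>k''$, make $M^{(0)}$ zero or empty: while $M^{(0)}$ has an entry $m_{ii}\ne0$, do $R_j\leftarrow R_j-\frac{m_{ij}}{m_{ii}}R_i$ for all $j\neq i$, output $m_{ii}$ and delete row and column $i$; if the diagonal of $M^{(0)}$ is zero but some $m_{ij}\ne0$, first do $R_j\leftarrow R_j+\frac12R_i$ and then $R_i\leftarrow R_i-R_j$, and use the resulting nonzero $m_{ii}$. 4. If still $k'>k''$, make $M^{(1)}$ upper triangular by Gaussian elimination on the type-i rows, output $k'-k''$ zeros, and delete the last $k'-k''$ type-i rows, which have become zero. * Finally, apply step 3's reduction to the root's box, first to $M^{(0)}$ and then to the whole remaining matrix, and output zeros for the remaining zero diagonal. Whenever several pairs of equally labeled rows or several pivots are available, any of them may be chosen, as specified by a fixed rule depending on the current box and the list of candidates. **Theorem.** Let $G$ be a graph on $n$ vertices with adjacency matrix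 $A$, given by a slick $k$-expression, and let $c\in\mathbb R$. However the choices are made, the list of numbers output by \texttt{diagonalize} consists of the diagonal entries (with multiplicity) of a diagonal matrix $D$ congruent to $A-cI$, that is, $D=P^{T}(A-cI)P$ for some nonsingular real matrix $P$. Moreover, the number of operations performed is at most $C\,k^3 n$, where $C$ is an absolute constant. Operations are arithmetic operations on real numbers, zero tests, comparisons and look-ups of labels, choices of a candidate, and writes of matrix entries, labels and output elements. -/

import Mathlib

namespace SlickDiag

/-! ## Slick expressions and the graphs they generate -/

/-- Slick `k`-expressions with vertex names in `V`; the label set `[k]` is `Fin k`.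
`atom i v` is `i(v)`, and `join S L R a b` is `a ⊕_{S,L,R} b`. -/
inductive SlickExpr (k : ℕ) (V : Type*) where
  | atom (i : Fin k) (v : V) : SlickExpr k V
  | join (S : Finset (Fin k × Fin k)) (L R : Fin k → Fin k) (a b : SlickExpr k V) : SlickExpr k V

namespace SlickExpr

variable {k : ℕ} {V : Type*} [DecidableEq V]

/-- The vertices created by an expression. -/
def verts : SlickExpr k V → Finset V
  | atom _ v => {v}
  | join _ _ _ a b => a.verts ∪ b.verts

/-- The label of each vertex in the labeled graph (only meaningful on `verts`). -/
def label : SlickExpr k V → V → Fin k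
  | atom i _ => fun _ => i
  | join _ L R a b => fun v => if v ∈ a.verts then L (a.label v) else R (b.label v)

/-- The edges of the graph produced by an expression, as a graph on all names. A join adds all
edges between a vertex labeled `i` on the left and a vertex labeled `j` on the right,
`(i, j) ∈ S`. -/
def graph : SlickExpr k V → SimpleGraph V
  | atom _ _ => ⊥
  | join S _ _ a b => a.graph ⊔ b.graph ⊔
      SimpleGraph.fromRel fun v w => v ∈ a.verts ∧ w ∈ b.verts ∧ (a.label v, b.label w) ∈ S

/-- The two operands of every join have disjoint vertex sets. -/
def WellFormed : SlickExpr k V → Prop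
  | atom _ _ => True
  | join _ _ _ a b => a.WellFormed ∧ b.WellFormed ∧ Disjoint a.verts b.verts

/-- `G` is the graph (with vertex set `V`) generated by the expression. -/
def Generates [Fintype V] (e : SlickExpr k V) (G : SimpleGraph V) : Prop :=
  e.WellFormed ∧ e.verts = Finset.univ ∧ e.graph = G

/-- The label of the leftmost leaf. -/
def leftmostLabel {V : Type*} : SlickExpr k V → Fin k
  | atom i _ => i
  | join _ _ _ a _ => a.leftmostLabel

/-- Replace the two relabelings at the root by one and the same constant map. This does not
change the generated graph. -/
def unifyRoot {V : Type*} : SlickExpr k V → SlickExpr k V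
  | atom i v => atom i v
  | join S _ _ a b => join S (fun _ => a.leftmostLabel) (fun _ => a.leftmostLabel) a b

end SlickExpr

/-! ## Computations with a step count -/

/-- A value together with the number of elementary operations spent on it. -/
structure Timed (α : Type) where
  val : α
  cost : ℕ

namespace Timed

instance : Monad Timed where
  pure x := ⟨x, 0⟩
  bind t f := ⟨(f t.val).val, t.cost + (f t.val).cost⟩

/-- A value obtained by one elementary operation. Elementary operations are: one arithmetic
operation on scalars, one test of a scalar for zero, one comparison of labels, one look-up in `S`,
`L` or `R`, one choice from a list, one write to memory or to the output. -/
def op {α : Type} (x : α) : Timed α := ⟨x, 1⟩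

variable {K : Type} [Field K]

def add (x y : K) : Timed K := op (x + y)
def neg (x : K) : Timed K := op (-x)
def mul (x y : K) : Timed K := op (x * y)
def div (x y : K) : Timed K := op (x / y)
def isNonzero [DecidableEq K] (x : K) : Timed Bool := op (decide (x ≠ 0))

/-- Fill an array: compute every entry and write it. -/
def tabulate {ι α : Type} [Fintype ι] (f : ι → Timed α) : Timed (ι → α) :=
  ⟨fun i => (f i).val, ∑ i, ((f i).cost + 1)⟩

/-- Fill a matrix: compute every entry and write it. -/
def tabulateMatrix {ι κ α : Type} [Fintype ι] [Fintype κ] (f : ι → κ → Timed α) :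
    Timed (Matrix ι κ α) :=
  ⟨Matrix.of fun i j => (f i j).val, ∑ i, ∑ j, ((f i j).cost + 1)⟩

/-- The sublist of the elements that pass the test. -/
def filter {α : Type} (test : α → Timed Bool) : List α → Timed (List α)
  | [] => pure []
  | x :: xs => do
    let t ← test x
    let ys ← filter test xs
    pure (if t then x :: ys else ys)

end Timed

open Timed

/-! ## Boxes -/

/-- A box `[k', k'', M, Λ]`: `k1 = k'` rows of type i, `k2 = k''` rows of type ii, the matrix `M`
with blocks `M⁽⁰⁾, M⁽¹⁾, M⁽¹⁾ᵀ, M⁽²⁾`, and a label for every row. -/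
structure Box (K : Type) (k : ℕ) where
  k1 : ℕ
  k2 : ℕ
  M : Matrix (Fin k1 ⊕ Fin k2) (Fin k1 ⊕ Fin k2) K
  lab : Fin k1 ⊕ Fin k2 → Fin k

/-- The algorithm leaves some choices open (which two rows of equal label, which pivot). A choice
rule makes them: given the current box it picks an element of a nonempty list of candidates. -/
structure ChoiceRule (K : Type) (k : ℕ) where
  pick : Box K k → ∀ {α : Type}, α → List α → α
  pick_mem : ∀ (b : Box K k) {α : Type} (x : α) (xs : List α), pick b x xs ∈ x :: xs

/-- The rule that always takes the first candidate. -/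
def firstChoice (K : Type) (k : ℕ) : ChoiceRule K k where
  pick _ _ x _ := x
  pick_mem _ _ _ _ := List.mem_cons_self

/-- Test all elements of a list and choose one that passes the test, if there is any. -/
def select {K : Type} {k : ℕ} (ρ : ChoiceRule K k) (b : Box K k) {α : Type}
    (test : α → Timed Bool) (l : List α) : Timed (Option α) := do
  let candidates ← Timed.filter test l
  match candidates with
  | [] => pure none
  | x :: xs => op (some (ρ.pick b x xs))

/-- All ordered pairs of distinct indices. -/
def distinctPairs (m : ℕ) : List (Fin m × Fin m) :=
  ((List.finRange m).product (List.finRange m)).filter fun p => p.1 ≠ p.2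

section RowOperations

variable {K : Type} [Field K] {ι κ : Type} [Fintype ι] [DecidableEq ι] [Fintype κ]

/-- `R_j ← R_j + a R_i`. -/
def addRow (i j : ι) (a : K) (M : Matrix ι ι K) : Timed (Matrix ι ι K) := do
  let r ← tabulate fun l => do
    let p ← mul a (M i l)
    add (M j l) p
  pure (M.updateRow j r)

/-- `C_j ← C_j + a C_i`. -/
def addCol (i j : ι) (a : K) (M : Matrix ι ι K) : Timed (Matrix ι ι K) := do
  let r ← tabulate fun l => do
    let p ← mul a (M l i)
    add (M l j) p
  pure (M.updateCol j r)

/-- The congruence operation `R_j ← R_j + a R_i`, `C_j ← C_j + a C_i`. -/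
def addRowCol (i j : ι) (a : K) (M : Matrix ι ι K) : Timed (Matrix ι ι K) := do
  let N ← addRow i j a M
  addCol i j a N

/-- `R_j ← R_j + q_j R_i` for all `j ≠ i`, followed by `C_j ← C_j + q_j C_i` for all `j ≠ i`. -/
def sweep (i : ι) (q : ι → K) (M : Matrix ι ι K) : Timed (Matrix ι ι K) := do
  let N ← tabulateMatrix fun j l =>
    if j = i then pure (M j l) else do
      let p ← mul (q j) (M i l)
      add (M j l) p
  tabulateMatrix fun l j =>
    if j = i then pure (N l j) else do
      let p ← mul (q j) (N l i)
      add (N l j) p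

/-- Copy the rows and columns listed by `f` (permutations, deletions). -/
def copyMatrix (f : κ → ι) (M : Matrix ι ι K) : Timed (Matrix κ κ K) :=
  tabulateMatrix fun a b => pure (M (f a) (f b))

/-- Copy the labels listed by `f`. -/
def copyLabels {k : ℕ} (f : κ → ι) (lab : ι → Fin k) : Timed (κ → Fin k) :=
  tabulate fun a => pure (lab (f a))

end RowOperations

section Algorithm

variable {K : Type} [Field K] [DecidableEq K] {k : ℕ}

/-- The box of a leaf `i(v)`: `[0, 1, [-c], [i]]`. -/
def leafBox (i : Fin k) (c : K) : Timed (Box K k) := do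
  let x ← neg c
  let M ← tabulateMatrix fun _ _ => pure x
  let lab ← tabulate fun _ => pure i
  pure ⟨0, 1, M, lab⟩

/-- The union of the matrices of two boxes, with ones placed between type-ii rows of the left box
and type-ii rows of the right box whose labels are related by `S`. -/
def formMatrix (S : Finset (Fin k × Fin k)) (a b : Box K k) :
    Timed (Matrix ((Fin a.k1 ⊕ Fin a.k2) ⊕ (Fin b.k1 ⊕ Fin b.k2))
      ((Fin a.k1 ⊕ Fin a.k2) ⊕ (Fin b.k1 ⊕ Fin b.k2)) K) :=
  tabulateMatrix fun x y =>
    match x, y with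
    | .inl i, .inl j => pure (a.M i j)
    | .inr i, .inr j => pure (b.M i j)
    | .inl (.inr i), .inr (.inr j) =>
        op (if (a.lab (.inr i), b.lab (.inr j)) ∈ S then 1 else 0)
    | .inr (.inr j), .inl (.inr i) =>
        op (if (a.lab (.inr i), b.lab (.inr j)) ∈ S then 1 else 0)
    | .inl (.inl _), .inr _ => pure 0
    | .inl (.inr _), .inr (.inl _) => pure 0
    | .inr (.inl _), .inl _ => pure 0
    | .inr (.inr _), .inl (.inl _) => pure 0

/-- The permutation that collects the type-i rows and the type-ii rows of two boxes. -/
def collect (a1 a2 b1 b2 : ℕ) :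
    Fin (a1 + b1) ⊕ Fin (a2 + b2) ≃ (Fin a1 ⊕ Fin a2) ⊕ (Fin b1 ⊕ Fin b2) :=
  (Equiv.sumCongr finSumFinEquiv.symm finSumFinEquiv.symm).trans
    (Equiv.sumSumSumComm (Fin a1) (Fin b1) (Fin a2) (Fin b2))

/-- The listing of rows in which the type-ii row `j` has become the last type-i row. -/
def demote {k1 k2 : ℕ} (j : Fin (k2 + 1)) : Fin (k1 + 1) ⊕ Fin k2 → Fin k1 ⊕ Fin (k2 + 1) :=
  Sum.elim (Fin.snoc (α := fun _ => Fin k1 ⊕ Fin (k2 + 1)) Sum.inl (Sum.inr j))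
    fun l => Sum.inr (j.succAbove l)

/-- As long as two type-ii rows `j', j` have equal labels, subtract row and column `j` from row and
column `j'`, which turns `j'` into a type-i row. -/
def mergeLabels (ρ : ChoiceRule K k) : (k1 k2 : ℕ) →
    Matrix (Fin k1 ⊕ Fin k2) (Fin k1 ⊕ Fin k2) K → (Fin k1 ⊕ Fin k2 → Fin k) → Timed (Box K k)
  | k1, 0, M, lab => pure ⟨k1, 0, M, lab⟩
  | k1, k2 + 1, M, lab => do
    let pair ← select ρ ⟨k1, k2 + 1, M, lab⟩
      (fun p => op (decide (lab (.inr p.1) = lab (.inr p.2)))) (distinctPairs (k2 + 1))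
    match pair with
    | none => pure ⟨k1, k2 + 1, M, lab⟩
    | some (j', j) => do
      let M₁ ← addRowCol (.inr j) (.inr j') (-1) M
      let M₂ ← copyMatrix (demote j') M₁
      let lab₂ ← copyLabels (demote j') lab
      mergeLabels ρ (k1 + 1) k2 M₂ lab₂

/-- Look for a nonzero diagonal entry of `M⁽⁰⁾`. If there is none but `M⁽⁰⁾` has a nonzero
off-diagonal entry `m_ij`, do `R_j ← R_j + ½ R_i`, `C_j ← C_j + ½ C_i`, `R_i ← R_i - R_j`,
`C_i ← C_i - C_j`, after which entry `ii` is nonzero. The result is `none` if `M⁽⁰⁾` is zero or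
empty, otherwise the matrix and a row `i` with nonzero diagonal entry. -/
def preparePivot (ρ : ChoiceRule K k) (b : Box K k) :
    Timed (Option (Fin b.k1 × Matrix (Fin b.k1 ⊕ Fin b.k2) (Fin b.k1 ⊕ Fin b.k2) K)) := do
  let diag ← select ρ b (fun i => isNonzero (b.M (.inl i) (.inl i))) (List.finRange b.k1)
  match diag with
  | some i => pure (some (i, b.M))
  | none => do
    let offDiag ← select ρ b (fun p => isNonzero (b.M (.inl p.1) (.inl p.2))) (distinctPairs b.k1)
    match offDiag with
    | none => pure none
    | some (i, j) => do
      let M₁ ← addRowCol (.inl i) (.inl j) (1 / 2) b.M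
      let M₂ ← addRowCol (.inl j) (.inl i) (-1) M₁
      pure (some (i, M₂))

/-- Make `M⁽⁰⁾` zero or empty: as long as there is a pivot `m_ii ≠ 0` in `M⁽⁰⁾`, subtract
`m_ij / m_ii` times row and column `i` from row and column `j` for all `j ≠ i`, output `m_ii`, and
remove row and column `i`. Returns the list of outputs and the remaining box. -/
def zeroM0 (ρ : ChoiceRule K k) {k2 : ℕ} : (k1 : ℕ) →
    Matrix (Fin k1 ⊕ Fin k2) (Fin k1 ⊕ Fin k2) K → (Fin k1 ⊕ Fin k2 → Fin k) →
    Timed (List K × Box K k)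
  | 0, M, lab => pure ([], ⟨0, k2, M, lab⟩)
  | m + 1, M, lab => do
    let pivot ← preparePivot ρ ⟨m + 1, k2, M, lab⟩
    match pivot with
    | none => pure ([], ⟨m + 1, k2, M, lab⟩)
    | some (i, N) => do
      let q ← tabulate fun j => do
        let x ← div (N (.inl i) j) (N (.inl i) (.inl i))
        neg x
      let N₁ ← sweep (.inl i) q N
      let d ← op (N₁ (.inl i) (.inl i))
      let N₂ ← copyMatrix (Sum.map i.succAbove id) N₁
      let lab₂ ← copyLabels (Sum.map i.succAbove id) lab
      let r ← zeroM0 ρ m N₂ lab₂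
      pure (d :: r.1, r.2)

/-- One round of Gaussian elimination in `M⁽¹⁾`, for column `t`: choose a row `p ≥ t` of `M⁽¹⁾` with
a nonzero entry in column `t` (if there is one), exchange it with row `t`, and subtract multiples
of row `t` to clear the entries below. The same is done to the columns. -/
def triangularStep (ρ : ChoiceRule K k) {k1 k2 : ℕ} (h : k2 < k1) (t : Fin k2)
    (s : Matrix (Fin k1 ⊕ Fin k2) (Fin k1 ⊕ Fin k2) K × (Fin k1 ⊕ Fin k2 → Fin k)) :
    Timed (Matrix (Fin k1 ⊕ Fin k2) (Fin k1 ⊕ Fin k2) K × (Fin k1 ⊕ Fin k2 → Fin k)) := do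
  let t' : Fin k1 := t.castLE h.le
  let row ← select ρ ⟨k1, k2, s.1, s.2⟩ (fun p => isNonzero (s.1 (.inl p) (.inr t)))
    ((List.finRange k1).filter fun p => t' ≤ p)
  match row with
  | none => pure s
  | some p => do
    let M ← copyMatrix (Equiv.swap (Sum.inl t') (Sum.inl p)) s.1
    let lab ← copyLabels (Equiv.swap (Sum.inl t') (Sum.inl p)) s.2
    let q ← tabulate fun x =>
      match x with
      | .inl j => if t' < j then do
          let y ← div (M (.inl j) (.inr t)) (M (.inl t') (.inr t))
          neg y
        else pure 0
      | .inr _ => pure 0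
    let N ← sweep (.inl t') q M
    pure (N, lab)

/-- For a box with `M⁽⁰⁾ = 0` and `k' > k''`: make `M⁽¹⁾` upper triangular, so that its last
`k' - k''` rows vanish, output a zero for each of these rows, and remove them. -/
def trimZeroRows (ρ : ChoiceRule K k) (b : Box K k) (h : b.k2 < b.k1) :
    Timed (List K × Box K k) := do
  let s ← (List.finRange b.k2).foldlM (fun s t => triangularStep ρ h t s) (b.M, b.lab)
  let M ← copyMatrix (Sum.map (Fin.castLE h.le) id) s.1
  let lab ← copyLabels (Sum.map (Fin.castLE h.le) id) s.2
  let zeros ← (List.replicate (b.k1 - b.k2) (0 : K)).mapM op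
  pure (zeros, ⟨b.k2, b.k2, M, lab⟩)

/-- `CombineBoxes` at a node `Q_ℓ ⊕_{S,L,R} Q_r`; returns the produced diagonal elements and the box
of the node. -/
def combineBoxes (ρ : ChoiceRule K k) (S : Finset (Fin k × Fin k)) (L R : Fin k → Fin k)
    (a b : Box K k) : Timed (List K × Box K k) := do
  let M₀ ← formMatrix S a b
  let lab₀ ← tabulate (Sum.elim (fun i => op (L (a.lab i))) (fun j => op (R (b.lab j))))
  let M₁ ← copyMatrix (collect a.k1 a.k2 b.k1 b.k2) M₀
  let lab₁ ← copyLabels (collect a.k1 a.k2 b.k1 b.k2) lab₀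
  let b₁ ← mergeLabels ρ (a.k1 + b.k1) (a.k2 + b.k2) M₁ lab₁
  let r₁ ← if b₁.k2 < b₁.k1 then zeroM0 ρ b₁.k1 b₁.M b₁.lab else pure ([], b₁)
  let r₂ ← if h : r₁.2.k2 < r₁.2.k1 then trimZeroRows ρ r₁.2 h else pure ([], r₁.2)
  pure (r₁.1 ++ r₂.1, r₂.2)

/-- The bottom-up (post-order) traversal of the parse tree; one further operation is charged per
node. Returns all diagonal elements produced so far and the box of the root. -/
def traverse {V : Type*} (ρ : ChoiceRule K k) (c : K) :
    SlickExpr k V → Timed (List K × Box K k)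
  | .atom i _ => do
    let _ ← op ()
    let b ← leafBox i c
    pure ([], b)
  | .join S L R x y => do
    let _ ← op ()
    let l ← traverse ρ c x
    let r ← traverse ρ c y
    let s ← combineBoxes ρ S L R l.2 r.2
    pure (l.1 ++ r.1 ++ s.1, s.2)

/-- Forget the distinction of types: all rows become type-i rows. -/
def allTypeI (b : Box K k) : Timed (Box K k) := do
  let f : Fin (b.k1 + b.k2) ⊕ Fin 0 → Fin b.k1 ⊕ Fin b.k2 :=
    Sum.elim finSumFinEquiv.symm Fin.elim0
  let M ← copyMatrix f b.M
  let lab ← copyLabels f b.lab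
  pure ⟨b.k1 + b.k2, 0, M, lab⟩

/-- `DiagonalizeBox`: make `M⁽⁰⁾` zero or empty, then diagonalize the remaining matrix by the same
transformations, and output its diagonal. -/
def diagonalizeBox (ρ : ChoiceRule K k) (b : Box K k) : Timed (List K) := do
  let r₁ ← zeroM0 ρ b.k1 b.M b.lab
  let b₂ ← allTypeI r₁.2
  let r₂ ← zeroM0 ρ b₂.k1 b₂.M b₂.lab
  let zeros ← (List.replicate r₂.2.k1 (0 : K)).mapM op
  pure (r₁.1 ++ r₂.1 ++ zeros)

/-- The algorithm `diagonalize`: input a slick `k`-expression and a scalar `c`, output the array of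
diagonal elements. -/
def diagonalize {V : Type*} (ρ : ChoiceRule K k) (e : SlickExpr k V) (c : K) :
    Timed (List K) := do
  let r ← traverse ρ c e.unifyRoot
  let d ← diagonalizeBox ρ r.2
  pure (r.1 ++ d)

end Algorithm

/-- `R ≅ S`: `R = Pᵀ S P` for a nonsingular matrix `P`. -/
def Congruent {V : Type*} [Fintype V] [DecidableEq V] (R S : Matrix V V ℝ) : Prop :=
  ∃ P : Matrix V V ℝ, IsUnit P.det ∧ R = P.transpose * S * P

end SlickDiag

/-!
The matrix `A - cI` of a subexpression is treated as a quadratic form together with one linear form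
per label, the indicator vector of the vertices with that label. A box stands for the same data in
another basis: its type-ii rows carry the labels, and the linear forms vanish on its type-i rows.
The invariant of the algorithm (`ReducesToBox`) is that the form and the linear forms of the
subexpression are congruent to those of the box plus an orthogonal diagonal part, on which the
linear forms vanish and whose diagonal is the list of numbers produced so far.

The invariant survives a join because the edges added by a join are the block `U₁ T U₂ᵀ`, where
`U₁`, `U₂` are the matrices of the linear forms and `T` is the 0/1 matrix of `S`. This block is
transformed correctly by any change of basis of the two operands, and a relabeling multiplies `U`
by a matrix from the right (`Reduces.join`). The remaining steps are elementary congruences: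
subtracting a row from another one with the same label makes the linear forms vanish there
(`mergeLabels_spec`), and adding multiples of type-i rows changes no linear form, so type-i rows can
be used as pivots and split off (`zeroM0_spec`, `trimZeroRows_spec`). At the root the linear forms
are forgotten and the rest is diagonalized.

For the running time, after each node the type-ii rows have distinct labels and there are at most
as many type-i rows, so a box has at most `2k` rows and a join works with at most `4k` rows. Every
loop at a node makes at most linearly many rounds in the number `m` of rows, and every round
costs `O(m²)`. An expression with `n` vertices has fewer than `2n` nodes.
-/

namespace SlickDiag

open Matrix Timed

/-! ### Congruence of matrices with labeled rows -/

section Congruence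

/-- The pair `(N, X)` arises from `(M, U)` by a change of basis: `N = Pᵀ M P` and `X = Pᵀ U` with
`P` invertible. Here `M` is a quadratic form and the columns of `U` are linear forms, one for each
label. The index types may differ, so invertibility is expressed by a two-sided inverse. -/
def LabelCongruent {ι ι' κ : Type*} [Fintype ι] [DecidableEq ι] [Fintype ι'] [DecidableEq ι']
    (M : Matrix ι ι ℝ) (U : Matrix ι κ ℝ) (N : Matrix ι' ι' ℝ) (X : Matrix ι' κ ℝ) : Prop :=
  ∃ (P : Matrix ι ι' ℝ) (Q : Matrix ι' ι ℝ),
    P * Q = 1 ∧ Q * P = 1 ∧ N = Pᵀ * M * P ∧ X = Pᵀ * U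

variable {ι ι' ι'' κ : Type*} [Fintype ι] [DecidableEq ι] [Fintype ι'] [DecidableEq ι']
  [Fintype ι''] [DecidableEq ι'']

namespace LabelCongruent

theorem refl (M : Matrix ι ι ℝ) (U : Matrix ι κ ℝ) : LabelCongruent M U M U :=
  ⟨1, 1, by simp, by simp, by simp, by simp⟩

theorem trans {M : Matrix ι ι ℝ} {U : Matrix ι κ ℝ} {N : Matrix ι' ι' ℝ} {X : Matrix ι' κ ℝ}
    {O : Matrix ι'' ι'' ℝ} {Y : Matrix ι'' κ ℝ} (h : LabelCongruent M U N X)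
    (h' : LabelCongruent N X O Y) : LabelCongruent M U O Y := by
  obtain ⟨P, Q, hPQ, hQP, rfl, rfl⟩ := h
  obtain ⟨P', Q', hPQ', hQP', rfl, rfl⟩ := h'
  refine ⟨P * P', Q' * Q, ?_, ?_, ?_, ?_⟩
  · rw [Matrix.mul_assoc, ← Matrix.mul_assoc P', hPQ', Matrix.one_mul, hPQ]
  · rw [Matrix.mul_assoc, ← Matrix.mul_assoc Q, hQP, Matrix.one_mul, hQP']
  · simp only [transpose_mul, Matrix.mul_assoc]
  · simp only [transpose_mul, Matrix.mul_assoc]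

theorem isSymm {M : Matrix ι ι ℝ} {U : Matrix ι κ ℝ} {N : Matrix ι' ι' ℝ} {X : Matrix ι' κ ℝ}
    (h : LabelCongruent M U N X) (hM : M.IsSymm) : N.IsSymm := by
  obtain ⟨P, Q, -, -, rfl, -⟩ := h
  unfold IsSymm
  rw [transpose_mul, transpose_mul, transpose_transpose, hM.eq, Matrix.mul_assoc]

theorem reindex (M : Matrix ι ι ℝ) (U : Matrix ι κ ℝ) {f : ι' → ι} (hf : f.Bijective) :
    LabelCongruent M U (M.submatrix f f) (U.submatrix f id) := by
  obtain ⟨e, rfl⟩ : ∃ e : ι' ≃ ι, ⇑e = f := ⟨Equiv.ofBijective f hf, rfl⟩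
  refine ⟨(1 : Matrix ι ι ℝ).submatrix id e, (1 : Matrix ι ι ℝ).submatrix e id, ?_, ?_, ?_, ?_⟩
  · rw [submatrix_mul_equiv]; simp
  · rw [← submatrix_mul _ _ _ _ _ Function.bijective_id]; simp
  · rw [transpose_submatrix, transpose_one]
    ext a b
    simp [Matrix.mul_apply, Matrix.one_apply]
  · rw [transpose_submatrix, transpose_one]
    ext a b
    simp [Matrix.mul_apply, Matrix.one_apply]

/-- A change of basis acts on the linear forms by multiplication from the left, so it commutes with
every linear operation on the labels. -/
theorem mul_right {κ' : Type*} [Fintype κ] {M : Matrix ι ι ℝ} {U : Matrix ι κ ℝ}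
    {N : Matrix ι' ι' ℝ} {X : Matrix ι' κ ℝ} (h : LabelCongruent M U N X) (T : Matrix κ κ' ℝ) :
    LabelCongruent M (U * T) N (X * T) := by
  obtain ⟨P, Q, hPQ, hQP, rfl, rfl⟩ := h
  exact ⟨P, Q, hPQ, hQP, rfl, Matrix.mul_assoc _ _ _⟩

/-- Congruences of two operands combine to a congruence of their join: the new edges form the
block `U₁ T U₂ᵀ`, which transforms correctly because it depends on the linear forms only. -/
theorem join {ι₁ ι₂ ι₁' ι₂' κ₁ κ₂ : Type*}
    [Fintype ι₁] [DecidableEq ι₁] [Fintype ι₁'] [DecidableEq ι₁']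
    [Fintype ι₂] [DecidableEq ι₂] [Fintype ι₂'] [DecidableEq ι₂'] [Fintype κ₁] [Fintype κ₂]
    {M₁ : Matrix ι₁ ι₁ ℝ} {U₁ : Matrix ι₁ κ₁ ℝ} {N₁ : Matrix ι₁' ι₁' ℝ} {X₁ : Matrix ι₁' κ₁ ℝ}
    {M₂ : Matrix ι₂ ι₂ ℝ} {U₂ : Matrix ι₂ κ₂ ℝ} {N₂ : Matrix ι₂' ι₂' ℝ} {X₂ : Matrix ι₂' κ₂ ℝ}
    (h₁ : LabelCongruent M₁ U₁ N₁ X₁) (h₂ : LabelCongruent M₂ U₂ N₂ X₂)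
    (T : Matrix κ₁ κ₂ ℝ) (L : Matrix κ₁ κ ℝ) (R : Matrix κ₂ κ ℝ) :
    LabelCongruent (fromBlocks M₁ (U₁ * T * U₂ᵀ) (U₂ * Tᵀ * U₁ᵀ) M₂)
      (fromRows (U₁ * L) (U₂ * R))
      (fromBlocks N₁ (X₁ * T * X₂ᵀ) (X₂ * Tᵀ * X₁ᵀ) N₂) (fromRows (X₁ * L) (X₂ * R)) := by
  obtain ⟨P₁, Q₁, hPQ₁, hQP₁, rfl, rfl⟩ := h₁
  obtain ⟨P₂, Q₂, hPQ₂, hQP₂, rfl, rfl⟩ := h₂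
  refine ⟨fromBlocks P₁ 0 0 P₂, fromBlocks Q₁ 0 0 Q₂, ?_, ?_, ?_, ?_⟩
  · simp [fromBlocks_multiply, hPQ₁, hPQ₂]
  · simp [fromBlocks_multiply, hQP₁, hQP₂]
  · simp [fromBlocks_multiply, fromBlocks_transpose, Matrix.mul_assoc]
  · simp [fromBlocks_transpose, fromBlocks_mul_fromRows, Matrix.mul_assoc]

end LabelCongruent

/-- The result of `R_a ← R_a + q_a R_i` for all `a`, followed by the same operation on the columns,
if `q_i = 0`. -/
def shear (i : ι) (q : ι → ℝ) (M : Matrix ι ι ℝ) : Matrix ι ι ℝ :=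
  of fun a b => M a b + q a * M i b + q b * (M a i + q a * M i i)

theorem labelCongruent_shear (M : Matrix ι ι ℝ) (U : Matrix ι κ ℝ) {i : ι} {q : ι → ℝ}
    (hq : q i = 0) :
    LabelCongruent M U (shear i q M) (of fun a s => U a s + q a * U i s) := by
  have hsq : vecMulVec (Pi.single i 1) q * vecMulVec (Pi.single i 1) q = 0 := by
    ext a b
    simp [Matrix.mul_apply, vecMulVec_apply, Pi.single_apply, hq]
  refine ⟨1 + vecMulVec (Pi.single i 1) q, 1 - vecMulVec (Pi.single i 1) q, ?_, ?_, ?_, ?_⟩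
  · simp [Matrix.add_mul, Matrix.mul_sub, hsq]
  · simp [Matrix.sub_mul, Matrix.mul_add, hsq]
  · ext a b
    simp [shear, Matrix.mul_apply, vecMulVec_apply, Pi.single_apply, Matrix.one_apply, add_mul,
      mul_add, Finset.sum_add_distrib]
    ring
  · ext a b
    simp [Matrix.mul_apply, vecMulVec_apply, Pi.single_apply, Matrix.one_apply, add_mul,
      Finset.sum_add_distrib]

/-- Operations with a row on which all linear forms vanish, such as a type-i row, do not change the
linear forms. -/
theorem labelCongruent_shear_of_row_eq_zero (M : Matrix ι ι ℝ) (U : Matrix ι κ ℝ) {i : ι}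
    {q : ι → ℝ} (hq : q i = 0) (hU : ∀ s, U i s = 0) :
    LabelCongruent M U (shear i q M) U := by
  have h := labelCongruent_shear M U hq
  have hU' : (of fun a s => U a s + q a * U i s) = U := by
    ext a s
    simp [hU]
  rwa [hU'] at h

end Congruence

/-! ### Splitting off diagonal entries -/

section Reduces

variable {ι ι' ι'' κ : Type*} [Fintype ι] [DecidableEq ι] [Fintype ι'] [DecidableEq ι']
  [Fintype ι''] [DecidableEq ι'']

/-- `(M, U)` is congruent to the orthogonal sum of `(N, X)` and a diagonal matrix on rows without
labels, whose diagonal is the list `out` up to order. -/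
def Reduces (M : Matrix ι ι ℝ) (U : Matrix ι κ ℝ) (out : List ℝ) (N : Matrix ι' ι' ℝ)
    (X : Matrix ι' κ ℝ) : Prop :=
  ∃ (δ : Type) (_ : Fintype δ) (_ : DecidableEq δ) (d : δ → ℝ),
    Finset.univ.val.map d = (out : Multiset ℝ) ∧
    LabelCongruent M U (fromBlocks (diagonal d) 0 0 N) (fromRows 0 X)

theorem LabelCongruent.reduces {M : Matrix ι ι ℝ} {U : Matrix ι κ ℝ} {N : Matrix ι' ι' ℝ}
    {X : Matrix ι' κ ℝ} (h : LabelCongruent M U N X) : Reduces M U [] N X := by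
  refine ⟨Empty, inferInstance, inferInstance, Empty.elim, by simp, h.trans ?_⟩
  convert LabelCongruent.reindex N X (Equiv.emptySum Empty ι').bijective using 1
  · ext (⟨⟨⟩⟩ | a) (⟨⟨⟩⟩ | b)
    simp
  · ext (⟨⟨⟩⟩ | a) b
    simp

/-- If a bijective listing of the rows starts with rows that are zero outside the diagonal and have
no label, then these can be removed. -/
theorem reduces_of_bijective {δ : Type} [Fintype δ] [DecidableEq δ] (M : Matrix ι ι ℝ)
    (U : Matrix ι κ ℝ) {f : δ → ι} {g : ι' → ι} (hfg : (Sum.elim f g).Bijective) {d : δ → ℝ}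
    {out : List ℝ} (hd : Finset.univ.val.map d = (out : Multiset ℝ))
    (hM : M.submatrix f f = diagonal d) (hrow : M.submatrix f g = 0) (hcol : M.submatrix g f = 0)
    (hU : U.submatrix f id = 0) :
    Reduces M U out (M.submatrix g g) (U.submatrix g id) := by
  refine ⟨δ, inferInstance, inferInstance, d, hd, ?_⟩
  convert LabelCongruent.reindex M U hfg using 1
  · rw [← hM, ← hrow, ← hcol]
    ext (a | a) (b | b) <;> rfl
  · rw [← hU]
    ext (a | a) b <;> rfl

namespace Reduces

theorem isSymm {M : Matrix ι ι ℝ} {U : Matrix ι κ ℝ} {out : List ℝ} {N : Matrix ι' ι' ℝ}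
    {X : Matrix ι' κ ℝ} (h : Reduces M U out N X) (hM : M.IsSymm) : N.IsSymm := by
  obtain ⟨δ, _, _, d, -, h⟩ := h
  exact (isSymm_fromBlocks_iff.mp (h.isSymm hM)).2.2.2

theorem mul_right {κ' : Type*} [Fintype κ] {M : Matrix ι ι ℝ} {U : Matrix ι κ ℝ} {out : List ℝ}
    {N : Matrix ι' ι' ℝ} {X : Matrix ι' κ ℝ} (h : Reduces M U out N X) (T : Matrix κ κ' ℝ) :
    Reduces M (U * T) out N (X * T) := by
  obtain ⟨δ, _, _, d, hd, h⟩ := h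
  refine ⟨δ, inferInstance, inferInstance, d, hd, ?_⟩
  have := h.mul_right T
  rwa [fromRows_mul, Matrix.zero_mul] at this

/-- The diagonal parts of two operands of a join have no labels, so they stay isolated. -/
theorem join {ι₁ ι₂ ι₁' ι₂' κ₁ κ₂ : Type*}
    [Fintype ι₁] [DecidableEq ι₁] [Fintype ι₁'] [DecidableEq ι₁']
    [Fintype ι₂] [DecidableEq ι₂] [Fintype ι₂'] [DecidableEq ι₂'] [Fintype κ₁] [Fintype κ₂]
    {M₁ : Matrix ι₁ ι₁ ℝ} {U₁ : Matrix ι₁ κ₁ ℝ} {N₁ : Matrix ι₁' ι₁' ℝ} {X₁ : Matrix ι₁' κ₁ ℝ}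
    {M₂ : Matrix ι₂ ι₂ ℝ} {U₂ : Matrix ι₂ κ₂ ℝ} {N₂ : Matrix ι₂' ι₂' ℝ} {X₂ : Matrix ι₂' κ₂ ℝ}
    {out₁ out₂ : List ℝ} (h₁ : Reduces M₁ U₁ out₁ N₁ X₁) (h₂ : Reduces M₂ U₂ out₂ N₂ X₂)
    (T : Matrix κ₁ κ₂ ℝ) (L : Matrix κ₁ κ ℝ) (R : Matrix κ₂ κ ℝ) :
    Reduces (fromBlocks M₁ (U₁ * T * U₂ᵀ) (U₂ * Tᵀ * U₁ᵀ) M₂)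
      (fromRows (U₁ * L) (U₂ * R)) (out₁ ++ out₂)
      (fromBlocks N₁ (X₁ * T * X₂ᵀ) (X₂ * Tᵀ * X₁ᵀ) N₂) (fromRows (X₁ * L) (X₂ * R)) := by
  obtain ⟨δ₁, _, _, d₁, hd₁, h₁⟩ := h₁
  obtain ⟨δ₂, _, _, d₂, hd₂, h₂⟩ := h₂
  refine ⟨δ₁ ⊕ δ₂, inferInstance, inferInstance, Sum.elim d₁ d₂, ?_, (h₁.join h₂ T L R).trans ?_⟩
  · rw [← Multiset.coe_add, ← hd₁, ← hd₂, ← Finset.univ_disjSum_univ, Finset.val_disjSum,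
      Multiset.disjSum, Multiset.map_add, Multiset.map_map, Multiset.map_map]
    rfl
  · convert LabelCongruent.reindex _ _ (Equiv.sumSumSumComm δ₁ δ₂ ι₁' ι₂').bijective using 1
    · ext ((a | a) | (a | a)) ((b | b) | (b | b)) <;>
        simp [Matrix.mul_apply, diagonal_apply]
    · ext ((a | a) | (a | a)) b <;> simp [Matrix.mul_apply]

theorem trans {M : Matrix ι ι ℝ} {U : Matrix ι κ ℝ} {out out' : List ℝ} {N : Matrix ι' ι' ℝ}
    {X : Matrix ι' κ ℝ} {O : Matrix ι'' ι'' ℝ} {Y : Matrix ι'' κ ℝ} [Fintype κ] [DecidableEq κ]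
    (h : Reduces M U out N X) (h' : Reduces N X out' O Y) : Reduces M U (out ++ out') O Y := by
  obtain ⟨δ, _, _, d, hd, h⟩ := h
  have h₀ : Reduces (diagonal d) (0 : Matrix δ κ ℝ) out (0 : Matrix Empty Empty ℝ) 0 := by
    refine ⟨δ, inferInstance, inferInstance, d, hd, ?_⟩
    convert LabelCongruent.reindex _ _ (Equiv.sumEmpty δ Empty).bijective using 1
    · ext (a | ⟨⟨⟩⟩) (b | ⟨⟨⟩⟩)
      simp
    · ext (a | ⟨⟨⟩⟩) b
      simp
  obtain ⟨δ', _, _, d', hd', h'⟩ := h₀.join h' 0 (1 : Matrix κ κ ℝ) (1 : Matrix κ κ ℝ)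
  refine ⟨δ', inferInstance, inferInstance, d', hd', ?_⟩
  simp only [Matrix.mul_zero, Matrix.zero_mul, Matrix.mul_one, transpose_zero] at h'
  refine (h.trans h').trans ?_
  convert LabelCongruent.reindex _ _
    ((Equiv.refl δ').sumCongr (Equiv.emptySum Empty ι'').symm).bijective using 1
  · ext (a | a) (b | b) <;> simp
  · ext (a | a) b <;> simp

theorem trans_labelCongruent {M : Matrix ι ι ℝ} {U : Matrix ι κ ℝ} {out : List ℝ}
    {N : Matrix ι' ι' ℝ} {X : Matrix ι' κ ℝ} {O : Matrix ι'' ι'' ℝ} {Y : Matrix ι'' κ ℝ}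
    [Fintype κ] [DecidableEq κ] (h : Reduces M U out N X) (h' : LabelCongruent N X O Y) :
    Reduces M U out O Y := by
  simpa using h.trans h'.reduces

end Reduces

/-- If `M` reduces to a matrix without rows, then the outputs are the diagonal of a diagonal matrix
congruent to `M`. -/
theorem Reduces.exists_congruent_diagonal [IsEmpty ι'] {M : Matrix ι ι ℝ} {U : Matrix ι κ ℝ}
    {out : List ℝ} {N : Matrix ι' ι' ℝ} {X : Matrix ι' κ ℝ} (h : Reduces M U out N X) :
    ∃ d : ι → ℝ, Congruent (diagonal d) M ∧ (out : Multiset ℝ) = Finset.univ.val.map d := by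
  obtain ⟨δ, _, _, d, hd, h⟩ := h
  have h' := h.trans (LabelCongruent.reindex _ _ (Equiv.sumEmpty δ ι').symm.bijective)
  obtain ⟨P, Q, hPQ, hQP, hN, -⟩ := h'
  have hcard : Fintype.card ι = Fintype.card δ :=
    Matrix.square_of_invertible P Q hPQ hQP
  let e : ι ≃ δ := Fintype.equivOfCardEq hcard
  refine ⟨d ∘ e, ⟨P.submatrix id e, ?_, ?_⟩, ?_⟩
  · refine (isUnit_iff_isUnit_det _).mp (IsUnit.of_mul_eq_one (Q.submatrix e id) ?_)
    rw [submatrix_mul_equiv, hPQ, submatrix_id_id]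
  · have hN' : diagonal d = Pᵀ * M * P := by
      rw [← hN]
      ext a b
      simp
    ext a b
    have := congrFun (congrFun hN' (e a)) (e b)
    simp only [diagonal_apply, e.injective.eq_iff] at this
    simpa [diagonal_apply, Matrix.mul_apply] using this
  · rw [← hd, ← Multiset.map_map]
    congr 1
    rw [← Finset.map_univ_equiv e]
    rfl

end Reduces

/-! ### Values and costs of the elementary procedures -/

namespace Timed

variable {α β : Type}

@[simp] theorem pure_val (x : α) : (pure x : Timed α).val = x := rfl
@[simp] theorem pure_cost (x : α) : (pure x : Timed α).cost = 0 := rfl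
@[simp] theorem bind_val (t : Timed α) (f : α → Timed β) : (t >>= f).val = (f t.val).val := rfl
@[simp] theorem bind_cost (t : Timed α) (f : α → Timed β) :
    (t >>= f).cost = t.cost + (f t.val).cost := rfl
@[simp] theorem map_val (g : α → β) (t : Timed α) : (g <$> t).val = g t.val := rfl
@[simp] theorem map_cost (g : α → β) (t : Timed α) : (g <$> t).cost = t.cost := rfl
@[simp] theorem op_val (x : α) : (op x).val = x := rfl
@[simp] theorem op_cost (x : α) : (op x).cost = 1 := rfl

/-- Costs add up, so the monad laws hold. -/
instance : LawfulMonad Timed := LawfulMonad.mk' Timed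
  (id_map := fun t => rfl)
  (pure_bind := fun x f => congrArg (Timed.mk (f x).val) (Nat.zero_add _))
  (bind_assoc := fun t f g => congrArg (Timed.mk (g (f t.val).val).val) (Nat.add_assoc _ _ _))

theorem filter_val (test : α → Timed Bool) (l : List α) :
    (filter test l).val = l.filter fun x => (test x).val := by
  induction l with
  | nil => rfl
  | cons x xs ih => simp only [filter, bind_val, pure_val, ih, List.filter_cons]

theorem filter_cost_le {test : α → Timed Bool} (h : ∀ x, (test x).cost ≤ 1) (l : List α) :
    (filter test l).cost ≤ l.length := by
  induction l with
  | nil => simp [filter]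
  | cons x xs ih =>
    have := h x
    simp only [filter, bind_cost, pure_cost, List.length_cons]
    lia

theorem mapM_op_val (l : List α) : (l.mapM op).val = l := by
  induction l with
  | nil => rfl
  | cons x xs ih => simp [List.mapM_cons, ih]

theorem mapM_op_cost (l : List α) : (l.mapM op).cost = l.length := by
  induction l with
  | nil => rfl
  | cons x xs ih => simp [List.mapM_cons, ih]; lia

end Timed

section Select

variable {k : ℕ} {α : Type} (ρ : ChoiceRule ℝ k) (b : Box ℝ k) {test : α → Timed Bool}
  {l : List α}

theorem select_cost_le (h : ∀ x, (test x).cost ≤ 1) (l : List α) :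
    (select ρ b test l).cost ≤ l.length + 1 := by
  have := filter_cost_le h l
  simp only [select, bind_cost]
  split <;> simp <;> lia

variable {ρ b}

theorem forall_test_of_select_eq_none (h : (select ρ b test l).val = none) :
    ∀ x ∈ l, (test x).val = false := by
  simp only [select, bind_val] at h
  split at h
  · next hl =>
    rw [filter_val, List.filter_eq_nil_iff] at hl
    simpa using hl
  · simp at h

theorem mem_of_select_eq_some {x : α} (h : (select ρ b test l).val = some x) :
    x ∈ l ∧ (test x).val = true := by
  simp only [select, bind_val] at h
  split at h
  · simp at h
  · next y ys hl =>
    simp only [op_val, Option.some.injEq] at h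
    have := ρ.pick_mem b y ys
    rw [h, ← hl, filter_val, List.mem_filter] at this
    exact this

end Select

theorem mem_distinctPairs {m : ℕ} {p : Fin m × Fin m} : p ∈ distinctPairs m ↔ p.1 ≠ p.2 := by
  simpa [distinctPairs] using fun _ =>
    List.pair_mem_product.mpr ⟨List.mem_finRange p.1, List.mem_finRange p.2⟩

theorem length_distinctPairs_le (m : ℕ) : (distinctPairs m).length ≤ m ^ 2 := by
  refine (List.length_filter_le _ _).trans ?_
  exact (List.length_product _ _).trans (by simp [sq]) |>.le

section RowOperations

variable {ι κ : Type} [Fintype κ]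

theorem copyMatrix_val (f : κ → ι) (M : Matrix ι ι ℝ) : (copyMatrix f M).val = M.submatrix f f :=
  rfl

theorem copyMatrix_cost (f : κ → ι) (M : Matrix ι ι ℝ) :
    (copyMatrix f M).cost = Fintype.card κ ^ 2 := by
  simp [copyMatrix, tabulateMatrix, sq]

theorem copyLabels_val {k : ℕ} (f : κ → ι) (lab : ι → Fin k) : (copyLabels f lab).val = lab ∘ f :=
  rfl

theorem copyLabels_cost {k : ℕ} (f : κ → ι) (lab : ι → Fin k) :
    (copyLabels f lab).cost = Fintype.card κ := by
  simp [copyLabels, tabulate]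

variable [Fintype ι] [DecidableEq ι]

theorem addRowCol_val (i j : ι) (a : ℝ) (M : Matrix ι ι ℝ) :
    (addRowCol i j a M).val = shear i (Pi.single j a) M := by
  ext x y
  by_cases hx : x = j <;> by_cases hy : y = j <;>
    simp [addRowCol, addRow, addCol, tabulate, Timed.add, Timed.mul, shear, updateRow_apply,
      Pi.single_apply, hx, hy]

theorem addRowCol_cost (i j : ι) (a : ℝ) (M : Matrix ι ι ℝ) :
    (addRowCol i j a M).cost = 6 * Fintype.card ι := by
  simp [addRowCol, addRow, addCol, tabulate, Timed.add, Timed.mul]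
  lia

theorem sweep_val (i : ι) (q : ι → ℝ) (M : Matrix ι ι ℝ) :
    (sweep i q M).val = shear i (Function.update q i 0) M := by
  ext x y
  by_cases hx : x = i <;> by_cases hy : y = i <;>
    simp [sweep, tabulateMatrix, Timed.add, Timed.mul, shear, hx, hy]

theorem sweep_cost_le (i : ι) (q : ι → ℝ) (M : Matrix ι ι ℝ) :
    (sweep i q M).cost ≤ 6 * Fintype.card ι ^ 2 := by
  have h (f : ι → ι → ℕ) (hf : ∀ x y, f x y ≤ 3) : ∑ x, ∑ y, f x y ≤ 3 * Fintype.card ι ^ 2 := by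
    calc ∑ x, ∑ y, f x y ≤ ∑ _x : ι, ∑ _y : ι, 3 :=
          Finset.sum_le_sum fun x _ => Finset.sum_le_sum fun y _ => hf x y
      _ = 3 * Fintype.card ι ^ 2 := by simp; ring
  simp only [sweep, bind_cost, tabulateMatrix]
  refine (add_le_add (h _ ?_) (h _ ?_)).trans (by lia) <;> intro x y <;> split <;>
    simp [Timed.add, Timed.mul]

end RowOperations

/-! ### Merging rows with equal labels -/

/-- The linear forms belonging to the labels of a box: type-i rows have no label, a type-ii row
has the one given by `lab`. -/
def typeIILabels {k k1 k2 : ℕ} (lab : Fin k1 ⊕ Fin k2 → Fin k) :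
    Matrix (Fin k1 ⊕ Fin k2) (Fin k) ℝ :=
  fromRows 0 (of fun j s => if lab (.inr j) = s then 1 else 0)

section Merge

variable {k : ℕ}

@[simp] theorem typeIILabels_inl {k1 k2 : ℕ} (lab : Fin k1 ⊕ Fin k2 → Fin k) (i : Fin k1)
    (s : Fin k) : typeIILabels lab (.inl i) s = 0 := rfl

@[simp] theorem typeIILabels_inr {k1 k2 : ℕ} (lab : Fin k1 ⊕ Fin k2 → Fin k) (j : Fin k2)
    (s : Fin k) : typeIILabels lab (.inr j) s = if lab (.inr j) = s then 1 else 0 := rfl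

/-- `(M, U)` splits into the diagonal entries `out` and the matrix and labels of the box `b`. -/
def ReducesToBox {ι : Type*} [Fintype ι] [DecidableEq ι] (M : Matrix ι ι ℝ)
    (U : Matrix ι (Fin k) ℝ) (out : List ℝ) (b : Box ℝ k) : Prop :=
  Reduces M U out b.M (typeIILabels b.lab)

/-- The type-ii rows of the box have pairwise distinct labels. -/
def Box.DistinctLabels (b : Box ℝ k) : Prop :=
  Function.Injective (b.lab ∘ Sum.inr)

theorem Box.DistinctLabels.k2_le {b : Box ℝ k} (h : b.DistinctLabels) : b.k2 ≤ k := by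
  simpa using Fintype.card_le_of_injective _ h

theorem demote_bijective {k1 k2 : ℕ} (j : Fin (k2 + 1)) :
    (demote (k1 := k1) j).Bijective := by
  rw [Fintype.bijective_iff_injective_and_card]
  refine ⟨?_, by simp; lia⟩
  rintro (x | x) (y | y) h
  · induction x using Fin.lastCases <;> induction y using Fin.lastCases <;>
      simp_all [demote]
  · induction x using Fin.lastCases <;> simp [demote, (Fin.succAbove_ne _ _).symm] at h
  · induction y using Fin.lastCases <;> simp [demote, Fin.succAbove_ne] at h
  · simpa [demote] using h

/-- Merging is a congruence: subtracting row `j` from row `j'` with the same label cancels the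
linear forms on `j'`, which may therefore become a type-i row. -/
theorem mergeLabels_spec (ρ : ChoiceRule ℝ k) : ∀ (k1 k2 : ℕ)
    (M : Matrix (Fin k1 ⊕ Fin k2) (Fin k1 ⊕ Fin k2) ℝ) (lab : Fin k1 ⊕ Fin k2 → Fin k),
    ReducesToBox M (typeIILabels lab) [] (mergeLabels ρ k1 k2 M lab).val ∧
    (mergeLabels ρ k1 k2 M lab).val.k1 + (mergeLabels ρ k1 k2 M lab).val.k2 = k1 + k2 ∧
    (mergeLabels ρ k1 k2 M lab).val.DistinctLabels
  | k1, 0, M, lab => by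
    rw [mergeLabels]
    exact ⟨(LabelCongruent.refl _ _).reduces, rfl, fun x => x.elim0⟩
  | k1, k2 + 1, M, lab => by
    rw [mergeLabels, bind_val]
    split
    · next h =>
      refine ⟨(LabelCongruent.refl _ _).reduces, rfl, fun x y hxy => ?_⟩
      by_contra hne
      have := forall_test_of_select_eq_none h (x, y) (mem_distinctPairs.mpr hne)
      simp only [op_val, decide_eq_false_iff_not] at this
      exact this hxy
    · next j' j h =>
      obtain ⟨hne, hlab⟩ := mem_of_select_eq_some h
      replace hne : j' ≠ j := mem_distinctPairs.mp hne
      replace hlab : lab (.inr j') = lab (.inr j) := by simpa using hlab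
      simp only [bind_val]
      rw [addRowCol_val, copyMatrix_val, copyLabels_val]
      obtain ⟨h₁, h₂, h₃⟩ := mergeLabels_spec ρ (k1 + 1) k2
        ((shear (.inr j) (Pi.single (.inr j') (-1)) M).submatrix (demote j') (demote j'))
        (lab ∘ demote j')
      refine ⟨Reduces.trans (out := []) (LabelCongruent.reduces ?_) h₁, h₂.trans (by lia), h₃⟩
      have hshear := labelCongruent_shear M (typeIILabels lab) (i := Sum.inr j)
        (q := Pi.single (.inr j') (-1)) (by simp [hne.symm])
      convert hshear.trans (LabelCongruent.reindex _ _ (demote_bijective j')) using 1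
      ext (x | x) s
      -- The new type-i row had the label of row `j`, which has been subtracted from it.
      · induction x using Fin.lastCases <;> simp [demote, hlab]
        split <;> norm_num
      · simp [demote, Fin.succAbove_ne]
        rfl

/-- There are at most `k2` rounds, since each of them uses up one type-ii row. -/
theorem mergeLabels_cost_le (ρ : ChoiceRule ℝ k) : ∀ (k1 k2 : ℕ)
    (M : Matrix (Fin k1 ⊕ Fin k2) (Fin k1 ⊕ Fin k2) ℝ) (lab : Fin k1 ⊕ Fin k2 → Fin k),
    (mergeLabels ρ k1 k2 M lab).cost ≤ 10 * (k1 + k2) ^ 2 * k2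
  | k1, 0, M, lab => by simp [mergeLabels]
  | k1, k2 + 1, M, lab => by
    rw [mergeLabels, bind_cost]
    have hsel := select_cost_le ρ ⟨k1, k2 + 1, M, lab⟩
      (test := fun p : Fin (k2 + 1) × Fin (k2 + 1) =>
        op (decide (lab (.inr p.1) = lab (.inr p.2)))) (fun _ => le_rfl) (distinctPairs (k2 + 1))
    have hlen := length_distinctPairs_le (k2 + 1)
    split
    · simp only [pure_cost]
      nlinarith [Nat.zero_le k1, Nat.zero_le k2]
    · next j' j h =>
      simp only [bind_cost, addRowCol_cost, copyMatrix_cost, copyLabels_cost]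
      refine (add_le_add le_rfl (add_le_add le_rfl (add_le_add le_rfl (add_le_add le_rfl
        (mergeLabels_cost_le ρ (k1 + 1) k2 _ _))))).trans ?_
      simp only [Fintype.card_sum, Fintype.card_fin]
      rw [show k1 + 1 + k2 = k1 + (k2 + 1) by ring]
      have h₁ : (k2 + 1) ^ 2 ≤ (k1 + (k2 + 1)) ^ 2 := Nat.pow_le_pow_left (by lia) 2
      have h₂ : k1 + (k2 + 1) ≤ (k1 + (k2 + 1)) ^ 2 := Nat.le_self_pow (by lia) _
      nlinarith

end Merge

/-! ### Diagonalizing the block of the type-i rows -/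

section ZeroM0

variable {k : ℕ}

/-- The block `M⁽⁰⁾` of the box is zero or empty. -/
def Box.M0Zero (b : Box ℝ k) : Prop :=
  ∀ i j, b.M (.inl i) (.inl j) = 0

theorem typeIILabels_submatrix_map {k1 k2 m : ℕ} (lab : Fin k1 ⊕ Fin k2 → Fin k)
    (f : Fin m → Fin k1) :
    (typeIILabels lab).submatrix (Sum.map f id) id = typeIILabels (lab ∘ Sum.map f id) := by
  ext (a | a) s <;> rfl

theorem preparePivot_eq_none {ρ : ChoiceRule ℝ k} {b : Box ℝ k}
    (h : (preparePivot ρ b).val = none) : b.M0Zero := by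
  simp only [preparePivot, bind_val] at h
  split at h
  · simp at h
  · next hdiag =>
    simp only [bind_val] at h
    split at h
    · next hoff =>
      intro i j
      by_cases hij : i = j
      · subst hij
        have := forall_test_of_select_eq_none hdiag i (List.mem_finRange i)
        simpa [isNonzero] using this
      · have := forall_test_of_select_eq_none hoff (i, j) (mem_distinctPairs.mpr hij)
        simpa [isNonzero] using this
    · simp at h

/-- A pivot is prepared by operations with type-i rows only, so the linear forms do not change. -/
theorem preparePivot_eq_some {ρ : ChoiceRule ℝ k} {b : Box ℝ k} {i : Fin b.k1}
    {N : Matrix (Fin b.k1 ⊕ Fin b.k2) (Fin b.k1 ⊕ Fin b.k2) ℝ} (hM : b.M.IsSymm)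
    (h : (preparePivot ρ b).val = some (i, N)) :
    LabelCongruent b.M (typeIILabels b.lab) N (typeIILabels b.lab) ∧ N (.inl i) (.inl i) ≠ 0 := by
  simp only [preparePivot, bind_val] at h
  split at h
  · next hdiag =>
    simp only [pure_val, Option.some.injEq, Prod.mk.injEq] at h
    obtain ⟨rfl, rfl⟩ := h
    refine ⟨.refl _ _, ?_⟩
    simpa [isNonzero] using (mem_of_select_eq_some hdiag).2
  · next hdiag =>
    simp only [bind_val] at h
    split at h
    · simp at h
    · next i' j hoff =>
      simp only [bind_val, pure_val, Option.some.injEq, Prod.mk.injEq] at h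
      obtain ⟨rfl, rfl⟩ := h
      obtain ⟨hij, hne⟩ := mem_of_select_eq_some hoff
      replace hij : i' ≠ j := mem_distinctPairs.mp hij
      replace hne : b.M (.inl i') (.inl j) ≠ 0 := by simpa [isNonzero] using hne
      have hzero (l : Fin b.k1) : b.M (.inl l) (.inl l) = 0 := by
        simpa [isNonzero] using forall_test_of_select_eq_none hdiag l (List.mem_finRange l)
      have hsymm : b.M (.inl j) (.inl i') = b.M (.inl i') (.inl j) := hM.apply _ _
      rw [addRowCol_val, addRowCol_val]
      refine ⟨(labelCongruent_shear_of_row_eq_zero _ _ ?_ fun _ => rfl).trans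
        (labelCongruent_shear_of_row_eq_zero _ _ ?_ fun _ => rfl), ?_⟩
      · simp [hij]
      · simp [hij.symm]
      · -- With zero diagonal entries at `i'` and `j`, the new entry is `m_jj - 2 m_ij = -m_ij`.
        simp only [shear, of_apply, Pi.single_apply, hzero, hsymm, Sum.inl.injEq, hij, if_true,
          if_false]
        intro h0
        apply hne
        linarith

theorem preparePivot_cost_le (ρ : ChoiceRule ℝ k) (b : Box ℝ k) :
    (preparePivot ρ b).cost ≤ b.k1 ^ 2 + 13 * (b.k1 + b.k2) + 2 := by
  simp only [preparePivot, bind_cost]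
  have h₁ := select_cost_le ρ b (test := fun i => isNonzero (b.M (.inl i) (.inl i)))
    (fun _ => le_rfl) (List.finRange b.k1)
  have h₂ := select_cost_le ρ b
    (test := fun p : Fin b.k1 × Fin b.k1 => isNonzero (b.M (.inl p.1) (.inl p.2)))
    (fun _ => le_rfl) (distinctPairs b.k1)
  have h₃ := length_distinctPairs_le b.k1
  rw [List.length_finRange] at h₁
  split
  · simp only [pure_cost]
    lia
  · simp only [bind_cost]
    split
    · simp only [pure_cost]
      lia
    · simp only [bind_cost, pure_cost, addRowCol_cost, Fintype.card_sum, Fintype.card_fin]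
      lia

theorem pivot_listing_bijective {m k2 : ℕ} (i : Fin (m + 1)) :
    (Sum.elim (fun _ : Unit => (Sum.inl i : Fin (m + 1) ⊕ Fin k2))
      (Sum.map i.succAbove id)).Bijective := by
  rw [Fintype.bijective_iff_injective_and_card]
  refine ⟨?_, by simp; lia⟩
  rintro (x | x | x) (y | y | y) h <;> simp_all [Fin.succAbove_ne, (Fin.succAbove_ne _ _).symm]

/-- Sweeping with a nonzero diagonal entry splits it off. -/
theorem reduces_pivot {m k2 : ℕ} {N : Matrix (Fin (m + 1) ⊕ Fin k2) (Fin (m + 1) ⊕ Fin k2) ℝ}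
    (hN : N.IsSymm) (lab : Fin (m + 1) ⊕ Fin k2 → Fin k) {i : Fin (m + 1)}
    (hi : N (.inl i) (.inl i) ≠ 0) {q : Fin (m + 1) ⊕ Fin k2 → ℝ}
    (hq : ∀ j, q j = -(N (.inl i) j / N (.inl i) (.inl i))) :
    Reduces N (typeIILabels lab) [(sweep (.inl i) q N).val (.inl i) (.inl i)]
      ((sweep (.inl i) q N).val.submatrix (Sum.map i.succAbove id) (Sum.map i.succAbove id))
      (typeIILabels (lab ∘ Sum.map i.succAbove id)) := by
  rw [sweep_val, ← typeIILabels_submatrix_map]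
  have hcong := labelCongruent_shear_of_row_eq_zero N (typeIILabels lab) (i := .inl i)
    (q := Function.update q (.inl i) 0) (by simp) (fun _ => rfl)
  have hsymm := hcong.isSymm hN
  have hrow : ∀ x ≠ Sum.inl i, shear (.inl i) (Function.update q (.inl i) 0) N (.inl i) x = 0 := by
    intro x hx
    simp [shear, hx, hq, hi]
  have hne (x : Fin m ⊕ Fin k2) : Sum.map i.succAbove id x ≠ Sum.inl i := by
    rcases x with x | x <;> simp [Fin.succAbove_ne]
  refine Reduces.trans (out := []) hcong.reduces (reduces_of_bijective _ _
    (pivot_listing_bijective i) (d := fun _ =>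
      shear (.inl i) (Function.update q (.inl i) 0) N (.inl i) (.inl i)) (by simp) ?_ ?_ ?_ ?_)
  · ext
    simp
  · ext _ x
    exact hrow _ (hne x)
  · ext x _
    exact (hsymm.apply _ _).trans (hrow _ (hne x))
  · ext _ s
    rfl

/-- Every round splits off one diagonal entry and one type-i row; the rounds end when no pivot is
left. -/
theorem zeroM0_spec (ρ : ChoiceRule ℝ k) {k2 : ℕ} : ∀ (k1 : ℕ)
    (M : Matrix (Fin k1 ⊕ Fin k2) (Fin k1 ⊕ Fin k2) ℝ) (lab : Fin k1 ⊕ Fin k2 → Fin k),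
    M.IsSymm →
    ReducesToBox M (typeIILabels lab) (zeroM0 ρ k1 M lab).val.1 (zeroM0 ρ k1 M lab).val.2 ∧
    (zeroM0 ρ k1 M lab).val.2.M0Zero ∧
    (zeroM0 ρ k1 M lab).val.2.k1 ≤ k1 ∧
    (zeroM0 ρ k1 M lab).val.2.k2 = k2 ∧
    (Function.Injective (lab ∘ Sum.inr) → (zeroM0 ρ k1 M lab).val.2.DistinctLabels)
  | 0, M, lab => fun _ => by
    rw [zeroM0]
    exact ⟨(LabelCongruent.refl _ _).reduces, fun i => i.elim0, le_rfl, rfl, id⟩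
  | m + 1, M, lab => fun hM => by
    rw [zeroM0, bind_val]
    split
    · next h =>
      exact ⟨(LabelCongruent.refl _ _).reduces, preparePivot_eq_none h, le_rfl, rfl, id⟩
    · next i N h =>
      obtain ⟨hcong, hi⟩ := preparePivot_eq_some (b := ⟨m + 1, k2, M, lab⟩) hM h
      simp only [bind_val, pure_val, op_val, copyMatrix_val, copyLabels_val]
      have hred := Reduces.trans (out := []) hcong.reduces (reduces_pivot (hcong.isSymm hM) lab hi
        (q := (tabulate fun j => do
          let x ← Timed.div (N (.inl i) j) (N (.inl i) (.inl i))
          Timed.neg x).val) fun _ => rfl)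
      obtain ⟨h₁, h₂, h₃, h₄, h₅⟩ := zeroM0_spec ρ m _ (lab ∘ Sum.map i.succAbove id)
        (hred.isSymm hM)
      exact ⟨hred.trans h₁, h₂, h₃.trans (Nat.le_succ m), h₄, fun hlab => h₅ hlab⟩

theorem zeroM0_cost_le (ρ : ChoiceRule ℝ k) {k2 : ℕ} : ∀ (k1 : ℕ)
    (M : Matrix (Fin k1 ⊕ Fin k2) (Fin k1 ⊕ Fin k2) ℝ) (lab : Fin k1 ⊕ Fin k2 → Fin k),
    (zeroM0 ρ k1 M lab).cost ≤ 28 * (k1 + k2) ^ 2 * k1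
  | 0, M, lab => by simp [zeroM0]
  | m + 1, M, lab => by
    rw [zeroM0, bind_cost]
    have hprep := preparePivot_cost_le ρ ⟨m + 1, k2, M, lab⟩
    dsimp only at hprep
    have h₁ : (m + 1) ^ 2 ≤ (m + 1 + k2) ^ 2 := Nat.pow_le_pow_left (by lia) 2
    have h₂ : m + 1 + k2 ≤ (m + 1 + k2) ^ 2 := Nat.le_self_pow (by lia) _
    have h₃ : (m + k2) ^ 2 ≤ (m + 1 + k2) ^ 2 := Nat.pow_le_pow_left (by lia) 2
    split
    · simp only [pure_cost]
      nlinarith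
    · next i N h =>
      simp only [bind_cost, pure_cost, op_cost, copyMatrix_cost, copyLabels_cost]
      refine (add_le_add hprep (add_le_add le_rfl (add_le_add (sweep_cost_le _ _ _) (add_le_add
        le_rfl (add_le_add le_rfl (add_le_add le_rfl (add_le_add (zeroM0_cost_le ρ m _ _)
        le_rfl))))))).trans ?_
      simp only [tabulate, bind_cost, Timed.div, Timed.neg, op_cost, Fintype.card_sum,
        Fintype.card_fin, Finset.sum_const, Finset.card_univ, smul_eq_mul]
      nlinarith [Nat.mul_le_mul_right m h₃]

end ZeroM0

/-! ### Removing superfluous type-i rows -/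

section Trim

variable {k k1 k2 : ℕ}

/-- Column `c` of `M⁽¹⁾` is zero below the diagonal. -/
def ClearedBelow (M : Matrix (Fin k1 ⊕ Fin k2) (Fin k1 ⊕ Fin k2) ℝ) (c : Fin k2) : Prop :=
  ∀ r : Fin k1, c.val < r.val → M (.inl r) (.inr c) = 0

/-- The multiples of row `t'` that clear column `t` of `M⁽¹⁾` below row `t'`. -/
noncomputable def clearingCoeffs (M : Matrix (Fin k1 ⊕ Fin k2) (Fin k1 ⊕ Fin k2) ℝ)
    (t' : Fin k1) (t : Fin k2) : Fin k1 ⊕ Fin k2 → ℝ :=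
  Sum.elim (fun j => if t' < j then -(M (.inl j) (.inr t) / M (.inl t') (.inr t)) else 0) 0

theorem swap_inl_inl (a b j : Fin k1) :
    Equiv.swap (Sum.inl a : Fin k1 ⊕ Fin k2) (.inl b) (.inl j) = .inl (Equiv.swap a b j) :=
  Sum.inl_injective.swap_apply a b j

theorem swap_inl_inr (a b : Fin k1) (c : Fin k2) :
    Equiv.swap (Sum.inl a : Fin k1 ⊕ Fin k2) (.inl b) (.inr c) = .inr c :=
  Equiv.swap_apply_of_ne_of_ne (by simp) (by simp)

theorem typeIILabels_submatrix_swap (lab : Fin k1 ⊕ Fin k2 → Fin k) (a b : Fin k1) :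
    (typeIILabels lab).submatrix (Equiv.swap (.inl a) (.inl b)) id =
      typeIILabels (lab ∘ Equiv.swap (.inl a) (.inl b)) := by
  ext (x | x) s
  · simp [swap_inl_inl]
  · simp [swap_inl_inr]

variable (ρ : ChoiceRule ℝ k) (h : k2 < k1)

/-- One round of the elimination uses type-i rows `≥ t` only. Hence it leaves the linear forms and a
zero block `M⁽⁰⁾` unchanged, and columns `c < t` that are already cleared remain so. -/
theorem triangularStep_spec (t : Fin k2)
    (s : Matrix (Fin k1 ⊕ Fin k2) (Fin k1 ⊕ Fin k2) ℝ × (Fin k1 ⊕ Fin k2 → Fin k)) :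
    LabelCongruent s.1 (typeIILabels s.2) (triangularStep ρ h t s).val.1
      (typeIILabels (triangularStep ρ h t s).val.2) ∧
    ((∀ i j, s.1 (.inl i) (.inl j) = 0) →
      ∀ i j, (triangularStep ρ h t s).val.1 (.inl i) (.inl j) = 0) ∧
    (triangularStep ρ h t s).val.2 ∘ Sum.inr = s.2 ∘ Sum.inr ∧
    (∀ c < t, ClearedBelow s.1 c → ClearedBelow (triangularStep ρ h t s).val.1 c) ∧
    ClearedBelow (triangularStep ρ h t s).val.1 t := by
  set t' : Fin k1 := t.castLE h.le with ht'
  rcases hsel : (select ρ ⟨k1, k2, s.1, s.2⟩ (fun p => isNonzero (s.1 (.inl p) (.inr t)))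
    ((List.finRange k1).filter fun p => t' ≤ p)).val with _ | p
  · have hval : (triangularStep ρ h t s).val = s := by
      simp only [triangularStep, bind_val, ← ht', hsel, pure_val]
    rw [hval]
    refine ⟨.refl _ _, id, rfl, fun _ _ => id, fun r hr => ?_⟩
    have hle : t' ≤ r := Fin.le_def.mpr hr.le
    simpa [isNonzero] using forall_test_of_select_eq_none hsel r (by simpa using hle)
  · obtain ⟨hp, hne⟩ := mem_of_select_eq_some hsel
    replace hp : t' ≤ p := by simpa using hp
    replace hne : s.1 (.inl p) (.inr t) ≠ 0 := by simpa [isNonzero] using hne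
    set M := s.1.submatrix (Equiv.swap (.inl t') (.inl p)) (Equiv.swap (.inl t') (.inl p)) with hM
    have hq0 : clearingCoeffs M t' t (.inl t') = 0 := by simp [clearingCoeffs]
    have hval : (triangularStep ρ h t s).val = (shear (.inl t') (clearingCoeffs M t' t) M,
        s.2 ∘ Equiv.swap (.inl t') (.inl p)) := by
      simp only [triangularStep, bind_val, ← ht', hsel, pure_val, sweep_val]
      refine congrArg (fun q => (shear (.inl t') q M, s.2 ∘ Equiv.swap (.inl t') (.inl p))) ?_
      rw [← Function.update_eq_self (Sum.inl t') (clearingCoeffs M t' t), hq0]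
      congr 1
      ext (j | j)
      · by_cases hj : t' < j <;>
          simp [tabulate, clearingCoeffs, hj, Timed.div, Timed.neg, copyMatrix_val, hM]
      · rfl
    have hM1 (r : Fin k1) (c : Fin k2) :
        M (.inl r) (.inr c) = s.1 (.inl (Equiv.swap t' p r)) (.inr c) := by
      rw [hM, submatrix_apply, swap_inl_inl, swap_inl_inr]
    rw [hval]
    refine ⟨?_, fun h0 i j => ?_, ?_, fun c hc hclear r hr => ?_, fun r hr => ?_⟩
    · have hswap := LabelCongruent.reindex s.1 (typeIILabels s.2)
        (Equiv.swap (Sum.inl t') (Sum.inl p)).bijective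
      rw [typeIILabels_submatrix_swap] at hswap
      exact hswap.trans (labelCongruent_shear_of_row_eq_zero _ _ hq0 fun _ => rfl)
    · simp [shear, hM, swap_inl_inl, h0]
    · ext c
      simp [swap_inl_inr]
    · have hct : c.val < t'.val := hc
      have hcp : c.val < p.val := hct.trans_le hp
      have hr' : c.val < (Equiv.swap t' p r).val := by
        rw [Equiv.swap_apply_def]
        split
        · exact hcp
        · split <;> assumption
      simp [shear, clearingCoeffs, hM1, hclear _ hr', hclear _ hcp]
    · have hr' : t' < r := hr
      have hpivot : M (.inl t') (.inr t) ≠ 0 := by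
        rw [hM1, Equiv.swap_apply_left]
        exact hne
      simp [shear, clearingCoeffs, hr', hpivot]

theorem triangularStep_cost_le (t : Fin k2)
    (s : Matrix (Fin k1 ⊕ Fin k2) (Fin k1 ⊕ Fin k2) ℝ × (Fin k1 ⊕ Fin k2 → Fin k)) :
    (triangularStep ρ h t s).cost ≤ 13 * (k1 + k2) ^ 2 := by
  have hsel := select_cost_le ρ ⟨k1, k2, s.1, s.2⟩
    (test := fun p => isNonzero (s.1 (.inl p) (.inr t))) (fun _ => le_rfl)
    ((List.finRange k1).filter fun p => t.castLE h.le ≤ p)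
  have hlen := List.length_filter_le (fun p => decide (t.castLE h.le ≤ p)) (List.finRange k1)
  rw [List.length_finRange] at hlen
  have h₁ : k1 + k2 ≤ (k1 + k2) ^ 2 := Nat.le_self_pow (by lia) _
  simp only [triangularStep, bind_cost]
  split
  · simp only [pure_cost]
    lia
  · simp only [bind_cost, pure_cost, copyMatrix_cost, copyLabels_cost]
    have hq (f : Fin k1 ⊕ Fin k2 → ℕ) (hf : ∀ x, f x ≤ 2) : ∑ x, (f x + 1) ≤ 3 * (k1 + k2) := by
      calc ∑ x, (f x + 1) ≤ ∑ _x : Fin k1 ⊕ Fin k2, 3 :=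
            Finset.sum_le_sum fun x _ => Nat.succ_le_succ (hf x)
        _ = 3 * (k1 + k2) := by simp; ring
    refine (add_le_add hsel (add_le_add le_rfl (add_le_add le_rfl (add_le_add (hq _ ?_)
      (add_le_add (sweep_cost_le _ _ _) le_rfl))))).trans ?_
    · rintro (x | x)
      · dsimp only
        split <;> simp [Timed.div, Timed.neg]
      · simp
    · simp only [Fintype.card_sum, Fintype.card_fin]
      lia

/-- The list `l` consists of the columns still to be processed, all others precede them and are
cleared. -/
theorem foldlM_triangularStep_spec : ∀ (l : List (Fin k2))
    (s : Matrix (Fin k1 ⊕ Fin k2) (Fin k1 ⊕ Fin k2) ℝ × (Fin k1 ⊕ Fin k2 → Fin k)),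
    l.Pairwise (· < ·) → (∀ c ∉ l, ∀ t ∈ l, c < t) → (∀ c ∉ l, ClearedBelow s.1 c) →
    (∀ i j, s.1 (.inl i) (.inl j) = 0) →
    LabelCongruent s.1 (typeIILabels s.2)
      (l.foldlM (fun s t => triangularStep ρ h t s) s).val.1
      (typeIILabels (l.foldlM (fun s t => triangularStep ρ h t s) s).val.2) ∧
    (∀ i j, (l.foldlM (fun s t => triangularStep ρ h t s) s).val.1 (.inl i) (.inl j) = 0) ∧
    (l.foldlM (fun s t => triangularStep ρ h t s) s).val.2 ∘ Sum.inr = s.2 ∘ Sum.inr ∧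
    ∀ c, ClearedBelow (l.foldlM (fun s t => triangularStep ρ h t s) s).val.1 c
  | [], s => fun _ _ hclear h0 => ⟨.refl _ _, h0, rfl, fun c => hclear c List.not_mem_nil⟩
  | t :: l, s => fun hl hlt hclear h0 => by
    rw [List.foldlM_cons, bind_val]
    obtain ⟨h₁, h₂, h₃, h₄, h₅⟩ := triangularStep_spec ρ h t s
    rw [List.pairwise_cons] at hl
    obtain ⟨g₁, g₂, g₃, g₄⟩ := foldlM_triangularStep_spec l (triangularStep ρ h t s).val hl.2
      (fun c hc u hu => by
        by_cases hct : c = t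
        · exact hct ▸ hl.1 u hu
        · exact hlt c (by simp [hct, hc]) u (List.mem_cons_of_mem _ hu))
      (fun c hc => by
        by_cases hct : c = t
        · exact hct ▸ h₅
        · have hc' : c ∉ t :: l := by simp [hct, hc]
          exact h₄ c (hlt c hc' t List.mem_cons_self) (hclear c hc'))
      (h₂ h0)
    exact ⟨h₁.trans g₁, g₂, g₃.trans h₃, g₄⟩

theorem foldlM_triangularStep_cost_le : ∀ (l : List (Fin k2))
    (s : Matrix (Fin k1 ⊕ Fin k2) (Fin k1 ⊕ Fin k2) ℝ × (Fin k1 ⊕ Fin k2 → Fin k)),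
    (l.foldlM (fun s t => triangularStep ρ h t s) s).cost ≤ 13 * (k1 + k2) ^ 2 * l.length
  | [], s => by simp
  | t :: l, s => by
    rw [List.foldlM_cons, bind_cost, List.length_cons, mul_add, mul_one, add_comm]
    exact add_le_add (foldlM_triangularStep_cost_le l _) (triangularStep_cost_le ρ h t s)

theorem trim_listing_bijective :
    (Sum.elim (fun r : Fin (k1 - k2) => (Sum.inl ⟨k2 + r, by lia⟩ : Fin k1 ⊕ Fin k2))
      (Sum.map (Fin.castLE h.le) id)).Bijective := by
  rw [Fintype.bijective_iff_injective_and_card]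
  refine ⟨?_, by simp; lia⟩
  rintro (x | x | x) (y | y | y) hxy <;> simp [Fin.ext_iff] at hxy ⊢ <;> lia

/-- If `M⁽⁰⁾ = 0` and `M⁽¹⁾` is upper triangular, the last `k' - k''` type-i rows are zero. By
symmetry so are the columns, and the rows split off with diagonal entries `0`. -/
theorem trimZeroRows_spec (b : Box ℝ k) (h : b.k2 < b.k1) (hM : b.M.IsSymm) (h0 : b.M0Zero) :
    ReducesToBox b.M (typeIILabels b.lab) (trimZeroRows ρ b h).val.1 (trimZeroRows ρ b h).val.2 ∧
    (trimZeroRows ρ b h).val.2.k1 = b.k2 ∧ (trimZeroRows ρ b h).val.2.k2 = b.k2 ∧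
    (b.DistinctLabels → (trimZeroRows ρ b h).val.2.DistinctLabels) := by
  obtain ⟨h₁, h₂, h₃, h₄⟩ := foldlM_triangularStep_spec ρ h (List.finRange b.k2) (b.M, b.lab)
    (List.pairwise_lt_finRange _) (by simp) (by simp) h0
  simp only [trimZeroRows, bind_val, pure_val, copyMatrix_val, copyLabels_val, mapM_op_val]
  refine ⟨Reduces.trans (out := []) h₁.reduces ?_, trivial, trivial, fun hb => ?_⟩
  · have hsymm := h₁.isSymm hM
    -- In an upper triangular `M⁽¹⁾` the rows from number `k''` on are below the diagonal.
    have hrow (r : Fin (b.k1 - b.k2)) (x : Fin b.k1 ⊕ Fin b.k2) :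
        ((List.finRange b.k2).foldlM (fun s t => triangularStep ρ h t s) (b.M, b.lab)).val.1
          (.inl ⟨b.k2 + r, by lia⟩) x = 0 := by
      rcases x with x | x
      · exact h₂ _ _
      · exact h₄ x _ (by simp; lia)
    dsimp only
    rw [← typeIILabels_submatrix_map]
    refine reduces_of_bijective _ _ (trim_listing_bijective h) (d := fun _ => 0)
      (by simp [Multiset.coe_replicate])
      ?_ ?_ ?_ ?_
    · ext x y
      simp [hrow]
    · ext x y
      exact hrow _ _
    · ext x y
      exact (hsymm.apply _ _).trans (hrow _ _)
    · ext x s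
      rfl
  · have heq : (((List.finRange b.k2).foldlM (fun s t => triangularStep ρ h t s)
        (b.M, b.lab)).val.2 ∘ Sum.map (Fin.castLE h.le) id) ∘ Sum.inr = b.lab ∘ Sum.inr := h₃
    unfold Box.DistinctLabels at hb ⊢
    rwa [heq]

theorem trimZeroRows_cost_le (b : Box ℝ k) (h : b.k2 < b.k1) :
    (trimZeroRows ρ b h).cost ≤ 16 * (b.k1 + b.k2) ^ 3 := by
  simp only [trimZeroRows, bind_cost, pure_cost, copyMatrix_cost, copyLabels_cost, mapM_op_cost,
    Fintype.card_sum, Fintype.card_fin, List.length_replicate]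
  have h₁ := foldlM_triangularStep_cost_le ρ h (List.finRange b.k2) (b.M, b.lab)
  rw [List.length_finRange] at h₁
  have h₂ : (b.k1 + b.k2) ^ 2 * b.k2 ≤ (b.k1 + b.k2) ^ 3 := by
    rw [pow_succ _ 2]
    exact Nat.mul_le_mul_left _ (by lia)
  have h₃ : (b.k2 + b.k2) ^ 2 ≤ (b.k1 + b.k2) ^ 3 :=
    (Nat.pow_le_pow_left (by lia) 2).trans (Nat.pow_le_pow_right (by lia) (by lia))
  have h₄ : b.k1 + b.k2 ≤ (b.k1 + b.k2) ^ 3 := Nat.le_self_pow (by lia) _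
  lia

end Trim

/-! ### Processing a join node -/

section Combine

variable {k : ℕ}

/-- The 0/1 matrix of a relabeling; multiplying label indicators by it from the right relabels. -/
def relabelMatrix (f : Fin k → Fin k) : Matrix (Fin k) (Fin k) ℝ :=
  of fun i s => if f i = s then 1 else 0

/-- The 0/1 matrix of the pairs of labels between which a join adds edges. -/
def joinMatrix (S : Finset (Fin k × Fin k)) : Matrix (Fin k) (Fin k) ℝ :=
  of fun i j => if (i, j) ∈ S then 1 else 0

theorem typeIILabels_mul_relabelMatrix {k1 k2 : ℕ} (lab : Fin k1 ⊕ Fin k2 → Fin k)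
    (f : Fin k → Fin k) : typeIILabels lab * relabelMatrix f = typeIILabels (f ∘ lab) := by
  ext (x | x) s <;> simp [Matrix.mul_apply]
  simp [relabelMatrix]

theorem formMatrix_val (S : Finset (Fin k × Fin k)) (a b : Box ℝ k) :
    (formMatrix S a b).val = fromBlocks a.M
      (typeIILabels a.lab * joinMatrix S * (typeIILabels b.lab)ᵀ)
      (typeIILabels b.lab * (joinMatrix S)ᵀ * (typeIILabels a.lab)ᵀ) b.M := by
  ext ((x | x) | (x | x)) ((y | y) | (y | y)) <;>
    simp [formMatrix, tabulateMatrix, Matrix.mul_apply] <;> simp [joinMatrix]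

theorem formMatrix_cost_le (S : Finset (Fin k × Fin k)) (a b : Box ℝ k) :
    (formMatrix S a b).cost ≤ 2 * (a.k1 + b.k1 + (a.k2 + b.k2)) ^ 2 := by
  simp only [formMatrix, tabulateMatrix]
  refine (Finset.sum_le_sum fun x _ => Finset.sum_le_sum (g := fun _ => 2) fun y _ => ?_).trans ?_
  · rcases x with (x | x) | (x | x) <;> rcases y with (y | y) | (y | y) <;> simp
  · simp only [Finset.sum_const, Finset.card_univ, Fintype.card_sum, Fintype.card_fin, smul_eq_mul]
    exact le_of_eq (by ring)

theorem typeIILabels_collect {a1 a2 b1 b2 : ℕ} (l₁ : Fin a1 ⊕ Fin a2 → Fin k)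
    (l₂ : Fin b1 ⊕ Fin b2 → Fin k) :
    (fromRows (typeIILabels l₁) (typeIILabels l₂)).submatrix (collect a1 a2 b1 b2) id =
      typeIILabels (Sum.elim l₁ l₂ ∘ collect a1 a2 b1 b2) := by
  ext (x | x) s
  · rcases hx : finSumFinEquiv.symm x with y | y <;> simp [collect, hx]
  · rcases hx : finSumFinEquiv.symm x with y | y <;> simp [collect, hx]

variable (ρ : ChoiceRule ℝ k)

/-- A continuation that has been copied into both branches of a conditional can be moved out. -/
theorem ite_bind_bind {α β : Type} (p : Prop) [Decidable p] (x y : Timed α) (f : α → Timed β) :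
    (if p then x >>= f else y >>= f) = (if p then x else y) >>= f := by
  split <;> rfl

theorem dite_bind_bind {α β : Type} (p : Prop) [Decidable p] (x : p → Timed α) (y : ¬p → Timed α)
    (f : α → Timed β) :
    (if h : p then x h >>= f else y h >>= f) = (if h : p then x h else y h) >>= f := by
  split <;> rfl

/-- The conditional reduction of `M⁽⁰⁾` at a join node. -/
theorem zeroM0_of_lt_spec {b : Box ℝ k} (hM : b.M.IsSymm) (hb : b.DistinctLabels)
    {r : Timed (List ℝ × Box ℝ k)}
    (hr : r = if b.k2 < b.k1 then zeroM0 ρ b.k1 b.M b.lab else pure ([], b)) :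
    ReducesToBox b.M (typeIILabels b.lab) r.val.1 r.val.2 ∧ r.val.2.DistinctLabels ∧
    (r.val.2.k2 < r.val.2.k1 → r.val.2.M0Zero) ∧
    r.val.2.k1 + r.val.2.k2 ≤ b.k1 + b.k2 ∧ r.cost ≤ 28 * (b.k1 + b.k2) ^ 3 := by
  split at hr
  · obtain ⟨h₁, h₂, h₃, h₄, h₅⟩ := zeroM0_spec ρ b.k1 b.M b.lab hM
    have hcost := zeroM0_cost_le ρ b.k1 b.M b.lab
    subst hr
    refine ⟨h₁, h₅ hb, fun _ => h₂, by lia, hcost.trans ?_⟩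
    rw [pow_succ _ 2, ← mul_assoc]
    exact Nat.mul_le_mul_left _ (by lia)
  · subst hr
    exact ⟨(LabelCongruent.refl _ _).reduces, hb, fun h => absurd h ‹_›, le_rfl, Nat.zero_le _⟩

/-- The conditional removal of superfluous type-i rows at a join node. -/
theorem trimZeroRows_of_lt_spec {b : Box ℝ k} (hM : b.M.IsSymm) (hb : b.DistinctLabels)
    (h0 : b.k2 < b.k1 → b.M0Zero) {r : Timed (List ℝ × Box ℝ k)}
    (hr : r = if h : b.k2 < b.k1 then trimZeroRows ρ b h else pure ([], b)) :
    ReducesToBox b.M (typeIILabels b.lab) r.val.1 r.val.2 ∧ r.val.2.DistinctLabels ∧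
    r.val.2.k1 ≤ r.val.2.k2 ∧ r.cost ≤ 16 * (b.k1 + b.k2) ^ 3 := by
  split at hr
  · next h =>
    obtain ⟨h₁, h₂, h₃, h₄⟩ := trimZeroRows_spec ρ b h hM (h0 h)
    have hcost := trimZeroRows_cost_le ρ b h
    subst hr
    exact ⟨h₁, h₄ hb, by lia, hcost⟩
  · next h =>
    subst hr
    exact ⟨(LabelCongruent.refl _ _).reduces, hb, not_lt.mp h, Nat.zero_le _⟩

/-- A join node: the reduction of the join of two boxes, the bounds on the rows of the new box, and
a cost cubic in the number of rows of the operands. -/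
theorem combineBoxes_spec (S : Finset (Fin k × Fin k)) (L R : Fin k → Fin k) {a b : Box ℝ k}
    (ha : a.M.IsSymm) (hb : b.M.IsSymm) :
    ReducesToBox (fromBlocks a.M (typeIILabels a.lab * joinMatrix S * (typeIILabels b.lab)ᵀ)
      (typeIILabels b.lab * (joinMatrix S)ᵀ * (typeIILabels a.lab)ᵀ) b.M)
      (fromRows (typeIILabels a.lab * relabelMatrix L) (typeIILabels b.lab * relabelMatrix R))
      (combineBoxes ρ S L R a b).val.1 (combineBoxes ρ S L R a b).val.2 ∧
    (combineBoxes ρ S L R a b).val.2.DistinctLabels ∧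
    (combineBoxes ρ S L R a b).val.2.k1 ≤ (combineBoxes ρ S L R a b).val.2.k2 ∧
    (combineBoxes ρ S L R a b).cost ≤ 60 * (a.k1 + b.k1 + (a.k2 + b.k2)) ^ 3 := by
  have hsymm : (fromBlocks a.M (typeIILabels a.lab * joinMatrix S * (typeIILabels b.lab)ᵀ)
      (typeIILabels b.lab * (joinMatrix S)ᵀ * (typeIILabels a.lab)ᵀ) b.M).IsSymm :=
    ha.fromBlocks (by simp [Matrix.mul_assoc]) hb
  have hreindex := LabelCongruent.reindex (fromBlocks a.M
      (typeIILabels a.lab * joinMatrix S * (typeIILabels b.lab)ᵀ)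
      (typeIILabels b.lab * (joinMatrix S)ᵀ * (typeIILabels a.lab)ᵀ) b.M)
    (fromRows (typeIILabels a.lab * relabelMatrix L) (typeIILabels b.lab * relabelMatrix R))
    (collect a.k1 a.k2 b.k1 b.k2).bijective
  have hformCost := formMatrix_cost_le S a b
  simp only [combineBoxes, ite_bind_bind, dite_bind_bind, bind_val, bind_cost, pure_val,
    pure_cost, copyMatrix_val, copyLabels_val, copyMatrix_cost, copyLabels_cost, formMatrix_val]
  have hlab : (tabulate (Sum.elim (fun i => op (L (a.lab i))) fun j => op (R (b.lab j)))).val =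
      Sum.elim (L ∘ a.lab) (R ∘ b.lab) := by
    ext (x | x) <;> rfl
  have hlabCost : (tabulate (Sum.elim (fun i => op (L (a.lab i))) fun j =>
      op (R (b.lab j)))).cost = 2 * (a.k1 + b.k1 + (a.k2 + b.k2)) := by
    simp [tabulate]
    ring
  rw [hlab, hlabCost]
  rw [typeIILabels_mul_relabelMatrix, typeIILabels_mul_relabelMatrix, typeIILabels_collect]
    at hreindex
  rw [typeIILabels_mul_relabelMatrix, typeIILabels_mul_relabelMatrix]
  generalize fromBlocks a.M (typeIILabels a.lab * joinMatrix S * (typeIILabels b.lab)ᵀ)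
      (typeIILabels b.lab * (joinMatrix S)ᵀ * (typeIILabels a.lab)ᵀ) b.M = M₀ at *
  obtain ⟨hm₁, hm₂, hm₃⟩ := mergeLabels_spec ρ (a.k1 + b.k1) (a.k2 + b.k2)
    (M₀.submatrix (collect a.k1 a.k2 b.k1 b.k2) (collect a.k1 a.k2 b.k1 b.k2))
    (Sum.elim (L ∘ a.lab) (R ∘ b.lab) ∘ collect a.k1 a.k2 b.k1 b.k2)
  have hmCost := mergeLabels_cost_le ρ (a.k1 + b.k1) (a.k2 + b.k2)
    (M₀.submatrix (collect a.k1 a.k2 b.k1 b.k2) (collect a.k1 a.k2 b.k1 b.k2))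
    (Sum.elim (L ∘ a.lab) (R ∘ b.lab) ∘ collect a.k1 a.k2 b.k1 b.k2)
  generalize mergeLabels ρ (a.k1 + b.k1) (a.k2 + b.k2)
    (M₀.submatrix (collect a.k1 a.k2 b.k1 b.k2) (collect a.k1 a.k2 b.k1 b.k2))
    (Sum.elim (L ∘ a.lab) (R ∘ b.lab) ∘ collect a.k1 a.k2 b.k1 b.k2) = t₁ at *
  have hred₁ := Reduces.trans (out := []) hreindex.reduces hm₁
  have hsymm₁ := hred₁.isSymm hsymm
  generalize hr₁ : (if t₁.val.k2 < t₁.val.k1 then zeroM0 ρ t₁.val.k1 t₁.val.M t₁.val.lab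
    else pure ([], t₁.val)) = r₁
  obtain ⟨hz₁, hz₂, hz₃, hz₄, hz₅⟩ := zeroM0_of_lt_spec ρ hsymm₁ hm₃ hr₁.symm
  have hred₂ := hred₁.trans hz₁
  have hsymm₂ := hred₂.isSymm hsymm
  generalize hr₂ : (if h : r₁.val.2.k2 < r₁.val.2.k1 then trimZeroRows ρ r₁.val.2 h
    else pure ([], r₁.val.2)) = r₂
  obtain ⟨ht₁, ht₂, ht₃, ht₄⟩ := trimZeroRows_of_lt_spec ρ hsymm₂ hz₂ hz₃ hr₂.symm
  refine ⟨hred₂.trans ht₁, ht₂, ht₃, ?_⟩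
  rw [hm₂] at hz₄ hz₅
  generalize hn : a.k1 + b.k1 + (a.k2 + b.k2) = n at *
  have h₁ : (r₁.val.2.k1 + r₁.val.2.k2) ^ 3 ≤ n ^ 3 := Nat.pow_le_pow_left hz₄ 3
  have h₂ : n ^ 2 * (a.k2 + b.k2) ≤ n ^ 3 := by
    rw [pow_succ n 2]
    exact Nat.mul_le_mul_left _ (by lia)
  have h₃ : n ≤ n ^ 3 := Nat.le_self_pow (by lia) n
  have h₄ : n ^ 2 ≤ n ^ 3 := by
    rcases Nat.eq_zero_or_pos n with h | h
    · simp [h]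
    · exact Nat.pow_le_pow_right h (by lia)
  simp only [Fintype.card_sum, Fintype.card_fin, hn]
  lia

end Combine

/-! ### The matrix of an expression -/

section Expressions

variable {k : ℕ} {V : Type*} [DecidableEq V]

namespace SlickExpr

open Classical in
/-- The matrix `A - cI` of the graph of an expression, on the vertices of the expression. -/
noncomputable def shiftedAdjMatrix (e : SlickExpr k V) (c : ℝ) : Matrix e.verts e.verts ℝ :=
  of fun v w => (if e.graph.Adj v w then 1 else 0) - if (v : V) = w then c else 0

/-- The indicator vectors of the labels of an expression. -/
def labelMatrix (e : SlickExpr k V) : Matrix e.verts (Fin k) ℝ :=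
  of fun v s => if e.label v = s then 1 else 0

theorem mem_verts_of_adj {e : SlickExpr k V} : ∀ {v w : V}, e.graph.Adj v w →
    v ∈ e.verts ∧ w ∈ e.verts := by
  induction e with
  | atom i v => simp [graph]
  | join S L R a b iha ihb =>
    intro v w h
    simp only [graph, SimpleGraph.sup_adj, SimpleGraph.fromRel_adj] at h
    simp only [verts, Finset.mem_union]
    rcases h with (h | h) | ⟨-, ⟨hv, hw, -⟩ | ⟨hw, hv, -⟩⟩
    · exact ⟨.inl (iha h).1, .inl (iha h).2⟩
    · exact ⟨.inr (ihb h).1, .inr (ihb h).2⟩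
    · exact ⟨.inl hv, .inr hw⟩
    · exact ⟨.inr hv, .inl hw⟩

theorem isSymm_shiftedAdjMatrix (e : SlickExpr k V) (c : ℝ) : (e.shiftedAdjMatrix c).IsSymm := by
  ext v w
  classical
  exact congrArg₂ (fun x y : ℝ => x - y) (if_congr (e.graph.adj_comm _ _) rfl rfl)
    (if_congr eq_comm rfl rfl)

variable {S : Finset (Fin k × Fin k)} {L R : Fin k → Fin k} {a b : SlickExpr k V}

/-- The vertices of a join are those of the two operands. -/
def joinVerts (S : Finset (Fin k × Fin k)) (L R : Fin k → Fin k) (h : Disjoint a.verts b.verts) :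
    a.verts ⊕ b.verts ≃ (join S L R a b).verts :=
  Equiv.Finset.union a.verts b.verts h

@[simp] theorem coe_joinVerts_inl (h : Disjoint a.verts b.verts) (v : a.verts) :
    (joinVerts S L R h (.inl v) : V) = v := rfl

@[simp] theorem coe_joinVerts_inr (h : Disjoint a.verts b.verts) (v : b.verts) :
    (joinVerts S L R h (.inr v) : V) = v := rfl

theorem shiftedAdjMatrix_join (h : Disjoint a.verts b.verts) (c : ℝ) :
    ((join S L R a b).shiftedAdjMatrix c).submatrix (joinVerts S L R h) (joinVerts S L R h) =
    fromBlocks (a.shiftedAdjMatrix c) (a.labelMatrix * joinMatrix S * b.labelMatrixᵀ)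
      (b.labelMatrix * (joinMatrix S)ᵀ * a.labelMatrixᵀ) (b.shiftedAdjMatrix c) := by
  classical
  have hab {v : V} (hv : v ∈ a.verts) : v ∉ b.verts := Finset.disjoint_left.mp h hv
  have hba {v : V} (hv : v ∈ b.verts) : v ∉ a.verts := Finset.disjoint_right.mp h hv
  have ha {v w : V} (hv : v ∈ b.verts) : ¬ a.graph.Adj v w := fun h =>
    hba hv (mem_verts_of_adj h).1
  have hb {v w : V} (hv : v ∈ a.verts) : ¬ b.graph.Adj v w := fun h =>
    hab hv (mem_verts_of_adj h).1
  ext (⟨v, hv⟩ | ⟨v, hv⟩) (⟨w, hw⟩ | ⟨w, hw⟩)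
  · simp [shiftedAdjMatrix]
    exact if_congr (by simp [graph, hab hv, hab hw, hb hv]) rfl rfl
  · simp [shiftedAdjMatrix, graph, labelMatrix, Matrix.mul_apply, hv, hw, hba hw,
      hb hv, a.graph.adj_comm v w, ha hw]
    simp [joinMatrix]
  · simp [shiftedAdjMatrix, graph, labelMatrix, Matrix.mul_apply, hv, hw, hba hv,
      b.graph.adj_comm v w, hb hw, ha hv]
    simp [joinMatrix]
  · simp [shiftedAdjMatrix]
    exact if_congr (by simp [graph, hba hv, hba hw, ha hv]) rfl rfl

theorem labelMatrix_join (h : Disjoint a.verts b.verts) :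
    (join S L R a b).labelMatrix.submatrix (joinVerts S L R h) id =
      fromRows (a.labelMatrix * relabelMatrix L) (b.labelMatrix * relabelMatrix R) := by
  have hba {v : V} (hv : v ∈ b.verts) : v ∉ a.verts := Finset.disjoint_right.mp h hv
  ext (⟨v, hv⟩ | ⟨v, hv⟩) s
  · simp [labelMatrix, label, Matrix.mul_apply, hv]
    simp [relabelMatrix]
  · simp [labelMatrix, label, Matrix.mul_apply, hba hv]
    simp [relabelMatrix]

theorem Generates.unifyRoot [Fintype V] {e : SlickExpr k V} {G : SimpleGraph V}
    (h : e.Generates G) : e.unifyRoot.Generates G := by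
  cases e <;> exact h

end SlickExpr

/-- The invariant of the traversal. A node costs at most `60 (4k)³ + 1 ≤ 4000 k³`, and a tree with
`n` leaves has `2 n - 1` nodes; this is the reason for the term on the left of the cost bound. -/
theorem traverse_spec (ρ : ChoiceRule ℝ k) (c : ℝ) {e : SlickExpr k V} : e.WellFormed →
    ReducesToBox (e.shiftedAdjMatrix c) e.labelMatrix (traverse ρ c e).val.1
      (traverse ρ c e).val.2 ∧
    (traverse ρ c e).val.2.DistinctLabels ∧
    (traverse ρ c e).val.2.k1 ≤ (traverse ρ c e).val.2.k2 ∧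
    (traverse ρ c e).cost + 4000 * k ^ 3 ≤ 8000 * k ^ 3 * e.verts.card := by
  induction e with
  | atom i v =>
    intro _
    have hk : 0 < k ^ 3 := Nat.pow_pos i.pos
    simp only [traverse, bind_val, bind_cost, pure_val, pure_cost, op_cost, leafBox, Timed.neg]
    refine ⟨?_, ?_, Nat.zero_le _, ?_⟩
    · refine LabelCongruent.reduces ?_
      have hbij : (fun _ : Fin 0 ⊕ Fin 1 =>
          (⟨v, Finset.mem_singleton_self v⟩ : ({v} : Finset V))).Bijective := by
        rw [Fintype.bijective_iff_injective_and_card]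
        exact ⟨fun x y _ => (Fintype.card_le_one_iff (α := Fin 0 ⊕ Fin 1)).mp (by simp) x y,
          by simp⟩
      convert LabelCongruent.reindex ((SlickExpr.atom i v).shiftedAdjMatrix c)
        (SlickExpr.atom i v).labelMatrix hbij using 1
      · ext (x | x) (y | y)
        · exact x.elim0
        · exact x.elim0
        · exact y.elim0
        · change -c = (SlickExpr.atom i v).shiftedAdjMatrix c ⟨v, Finset.mem_singleton_self v⟩
            ⟨v, Finset.mem_singleton_self v⟩
          simp [SlickExpr.shiftedAdjMatrix, SlickExpr.graph]
      · ext (x | x) s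
        · exact x.elim0
        · rfl
    · exact fun x y _ => Subsingleton.elim _ _
    · simp [tabulateMatrix, tabulate, SlickExpr.verts]
      lia
  | join S L R a b iha ihb =>
    rintro ⟨hwa, hwb, hdisj⟩
    obtain ⟨ha₁, ha₂, ha₃, ha₄⟩ := iha hwa
    obtain ⟨hb₁, hb₂, hb₃, hb₄⟩ := ihb hwb
    simp only [traverse, bind_val, bind_cost, pure_val, pure_cost, op_cost]
    generalize traverse ρ c a = l at *
    generalize traverse ρ c b = r at *
    obtain ⟨h₁, h₂, h₃, h₄⟩ := combineBoxes_spec ρ S L R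
      (ha₁.isSymm (a.isSymm_shiftedAdjMatrix c)) (hb₁.isSymm (b.isSymm_shiftedAdjMatrix c))
    refine ⟨?_, h₂, h₃, ?_⟩
    · have hunion := LabelCongruent.reindex
        ((SlickExpr.join S L R a b).shiftedAdjMatrix c) (SlickExpr.join S L R a b).labelMatrix
        (SlickExpr.joinVerts S L R hdisj).bijective
      rw [SlickExpr.shiftedAdjMatrix_join, SlickExpr.labelMatrix_join] at hunion
      exact (Reduces.trans (out := []) hunion.reduces
        (ha₁.join hb₁ (joinMatrix S) (relabelMatrix L) (relabelMatrix R))).trans h₁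
    · -- A box has at most `k` rows of type ii and no more rows of type i.
      have hn : l.val.2.k1 + r.val.2.k1 + (l.val.2.k2 + r.val.2.k2) ≤ 4 * k := by
        have := ha₂.k2_le
        have := hb₂.k2_le
        lia
      have hn3 := Nat.pow_le_pow_left hn 3
      rw [mul_pow] at hn3
      have hk : 0 < k ^ 3 := Nat.pow_pos a.leftmostLabel.pos
      rw [SlickExpr.verts, Finset.card_union_of_disjoint hdisj, mul_add]
      lia

end Expressions

/-! ### The root -/

section Root

variable {k : ℕ} (ρ : ChoiceRule ℝ k)

theorem allTypeI_spec (b : Box ℝ k) :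
    LabelCongruent b.M (0 : Matrix _ (Fin k) ℝ) (allTypeI b).val.M 0 := by
  have hf : (Sum.elim finSumFinEquiv.symm Fin.elim0 :
      Fin (b.k1 + b.k2) ⊕ Fin 0 → Fin b.k1 ⊕ Fin b.k2).Bijective := by
    rw [Fintype.bijective_iff_injective_and_card]
    refine ⟨?_, by simp⟩
    rintro (x | x) (y | y) hxy
    · simpa using hxy
    · exact y.elim0
    · exact x.elim0
    · exact x.elim0
  exact LabelCongruent.reindex b.M 0 hf

/-- A zero matrix is split off completely, leaving no rows. -/
theorem reduces_of_M0Zero {b : Box ℝ k} (h : b.M0Zero) (h2 : b.k2 = 0) :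
    Reduces b.M (0 : Matrix _ (Fin k) ℝ) (List.replicate b.k1 0)
      (0 : Matrix Empty Empty ℝ) 0 := by
  obtain ⟨k1, k2, M, lab⟩ := b
  subst h2
  have hf : (Sum.elim Sum.inl Empty.elim : Fin k1 ⊕ Empty → Fin k1 ⊕ Fin 0).Bijective := by
    rw [Fintype.bijective_iff_injective_and_card]
    refine ⟨?_, by simp⟩
    rintro (x | ⟨⟨⟩⟩) (y | ⟨⟨⟩⟩) hxy
    simpa using hxy
  have hred := reduces_of_bijective M (0 : Matrix _ (Fin k) ℝ) hf (d := fun _ => 0)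
    (out := List.replicate k1 0) (by simp [Multiset.coe_replicate])
    (by ext x y; simpa using h x y) (by ext x ⟨⟩) (by ext ⟨⟩) rfl
  convert hred using 1 <;> ext ⟨⟩

/-- At the root the labels are no longer needed, so all of them are dropped. -/
theorem diagonalizeBox_spec {b : Box ℝ k} (hM : b.M.IsSymm) :
    Reduces b.M (0 : Matrix _ (Fin k) ℝ) (diagonalizeBox ρ b).val
      (0 : Matrix Empty Empty ℝ) 0 := by
  obtain ⟨h₁, -, -, -, -⟩ := zeroM0_spec ρ b.k1 b.M b.lab hM
  simp only [diagonalizeBox, bind_val, pure_val, mapM_op_val]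
  generalize zeroM0 ρ b.k1 b.M b.lab = r₁ at *
  have h₁' := h₁.mul_right (0 : Matrix (Fin k) (Fin k) ℝ)
  rw [Matrix.mul_zero, Matrix.mul_zero] at h₁'
  have h₂ := h₁'.trans_labelCongruent (allTypeI_spec r₁.val.2)
  obtain ⟨h₃, h₄, -, h₅, -⟩ := zeroM0_spec ρ _ _ (allTypeI r₁.val.2).val.lab (h₂.isSymm hM)
  have h₃' := h₃.mul_right (0 : Matrix (Fin k) (Fin k) ℝ)
  rw [Matrix.mul_zero, Matrix.mul_zero] at h₃'
  exact (h₂.trans h₃').trans (reduces_of_M0Zero h₄ h₅)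

theorem diagonalizeBox_cost_le {b : Box ℝ k} (hM : b.M.IsSymm) :
    (diagonalizeBox ρ b).cost ≤ 60 * (b.k1 + b.k2) ^ 3 := by
  obtain ⟨h₁, -, hk1, hk2, -⟩ := zeroM0_spec ρ b.k1 b.M b.lab hM
  have hcost₁ := zeroM0_cost_le ρ b.k1 b.M b.lab
  simp only [diagonalizeBox, bind_cost, pure_cost, mapM_op_cost, List.length_replicate]
  generalize zeroM0 ρ b.k1 b.M b.lab = r₁ at *
  have h₁' := h₁.mul_right (0 : Matrix (Fin k) (Fin k) ℝ)
  rw [Matrix.mul_zero, Matrix.mul_zero] at h₁'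
  have h₂ := h₁'.trans_labelCongruent (allTypeI_spec r₁.val.2)
  obtain ⟨-, -, hk1', -, -⟩ := zeroM0_spec ρ _ _ (allTypeI r₁.val.2).val.lab (h₂.isSymm hM)
  have hcost₂ := zeroM0_cost_le ρ _ (allTypeI r₁.val.2).val.M (allTypeI r₁.val.2).val.lab
  generalize zeroM0 ρ _ (allTypeI r₁.val.2).val.M (allTypeI r₁.val.2).val.lab = r₂ at *
  have hrows : (allTypeI r₁.val.2).val.k1 = r₁.val.2.k1 + r₁.val.2.k2 := rfl
  have hrows' : (allTypeI r₁.val.2).val.k2 = 0 := rfl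
  have hallCost : (allTypeI r₁.val.2).cost =
      (r₁.val.2.k1 + r₁.val.2.k2) ^ 2 + (r₁.val.2.k1 + r₁.val.2.k2) := by
    simp [allTypeI, copyMatrix_cost, copyLabels_cost]
  rw [hallCost]
  rw [hrows, hrows', add_zero, mul_assoc, ← pow_succ] at hcost₂
  rw [hrows] at hk1'
  have hn : r₁.val.2.k1 + r₁.val.2.k2 ≤ b.k1 + b.k2 := by lia
  generalize r₁.val.2.k1 + r₁.val.2.k2 = m at *
  have h₁ : (b.k1 + b.k2) ^ 2 * b.k1 ≤ (b.k1 + b.k2) ^ 3 := by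
    rw [pow_succ _ 2]
    exact Nat.mul_le_mul_left _ (by lia)
  have h₃ : m ^ 3 ≤ (b.k1 + b.k2) ^ 3 := Nat.pow_le_pow_left hn 3
  have h₄ : m ≤ m ^ 3 := Nat.le_self_pow (by lia) m
  have h₅ : m ^ 2 ≤ m ^ 3 := by
    rcases Nat.eq_zero_or_pos m with h | h
    · simp [h]
    · exact Nat.pow_le_pow_right h (by lia)
  lia

/-- The outputs form a diagonal matrix congruent to `A - cI`, and the cost is at most
`8000 k³ n` for the traversal plus `60 (2k)³` for the box of the root. -/
theorem diagonalize_spec {V : Type*} [Fintype V] [DecidableEq V] {G : SimpleGraph V}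
    [DecidableRel G.Adj] {e : SlickExpr k V} (he : e.Generates G) (c : ℝ) :
    (∃ d : V → ℝ, Congruent (diagonal d) (G.adjMatrix ℝ - c • (1 : Matrix V V ℝ)) ∧
      ((diagonalize ρ e c).val : Multiset ℝ) = Finset.univ.val.map d) ∧
    (diagonalize ρ e c).cost ≤ 8500 * k ^ 3 * Fintype.card V := by
  obtain ⟨hwf, hverts, hgraph⟩ := he.unifyRoot
  obtain ⟨h₁, h₂, h₃, h₄⟩ := traverse_spec ρ c hwf
  have hsymm := h₁.isSymm (e.unifyRoot.isSymm_shiftedAdjMatrix c)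
  constructor
  · have hbij : (Subtype.val : e.unifyRoot.verts → V).Bijective :=
      ⟨Subtype.val_injective, fun v => ⟨⟨v, hverts ▸ Finset.mem_univ v⟩, rfl⟩⟩
    have h₀ := LabelCongruent.reindex (G.adjMatrix ℝ - c • (1 : Matrix V V ℝ))
      (0 : Matrix V (Fin k) ℝ) hbij
    have hM : (G.adjMatrix ℝ - c • (1 : Matrix V V ℝ)).submatrix Subtype.val Subtype.val =
        e.unifyRoot.shiftedAdjMatrix c := by
      subst hgraph
      ext v w
      simp [SlickExpr.shiftedAdjMatrix, SimpleGraph.adjMatrix_apply, Matrix.one_apply]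
    rw [hM] at h₀
    have h₁' := h₁.mul_right (0 : Matrix (Fin k) (Fin k) ℝ)
    rw [Matrix.mul_zero, Matrix.mul_zero] at h₁'
    exact ((Reduces.trans (out := []) h₀.reduces h₁').trans
      (diagonalizeBox_spec ρ hsymm)).exists_congruent_diagonal
  · have hcost := diagonalizeBox_cost_le ρ hsymm
    have hn : (traverse ρ c e.unifyRoot).val.2.k1 + (traverse ρ c e.unifyRoot).val.2.k2 ≤
        2 * k := by
      have := h₂.k2_le
      lia
    have hn3 := Nat.pow_le_pow_left hn 3
    rw [mul_pow] at hn3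
    rw [hverts, Finset.card_univ] at h₄
    simp only [diagonalize, Timed.bind_cost, Timed.pure_cost]
    lia

end Root

end SlickDiag

theorem mainTheorem2 :
    ∃ C : ℕ, ∀ (V : Type*) [Fintype V] [DecidableEq V] (G : SimpleGraph V) [DecidableRel G.Adj]
      (k : ℕ) (e : SlickDiag.SlickExpr k V) (_ : e.Generates G) (c : ℝ)
      (ρ : SlickDiag.ChoiceRule ℝ k),
      (∃ d : V → ℝ,
        SlickDiag.Congruent (Matrix.diagonal d) (G.adjMatrix ℝ - c • (1 : Matrix V V ℝ)) ∧
        ((SlickDiag.diagonalize ρ e c).val : Multiset ℝ) = Finset.univ.val.map d) ∧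
      (SlickDiag.diagonalize ρ e c).cost ≤ C * k ^ 3 * Fintype.card V := by
  exact ⟨8500, fun V _ _ G _ k e he c ρ => SlickDiag.diagonalize_spec ρ he c⟩
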